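/- A virtual knot diagram is a (polygonal) closed curve in general position in the plane, with finitely many transverse double points, each of which is marked either as a classical crossing (with over/under information) or as a virtual crossing. Two diagrams are equivalent if one is obtained from the other by finitely many planar isotopies, classical Reidemeister moves and detour moves, where a detour move replaces an arc of the diagram, all of whose crossings (possibly none) are virtual, by any other arc with the same end points all of whose crossings are virtual. A virtual knot $K$ is an equivalence class of virtual knot diagrams. Its classical crossing number $\mathrm{cr}_c(K)$ is the smallest number of classical crossings among all diagrams of $K$, and its total crossing number $\mathrm{cr}_t(K)$ is the smallest number of all (classical and virtual) crossings among all diagrams of $K$. Proposition. Let $K$ be a virtual knot with $\mathrm{cr}_c(K)=n$. Then $\mathrm{cr}_t(K)\le 6n^2-2n$. -/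

import Mathlib

open scoped Topology unitInterval

/-- The plane in which diagrams are drawn (only its affine structure and its topology are used). -/
abbrev Plane : Type := ℝ × ℝ

namespace VirtualKnot

/-- The closed straight line segment with the given unordered pair of end points. -/
def seg (e : Sym2 Plane) : Set Plane := convexHull ℝ {p | p ∈ e}

/-- The edges of the polygonal path that visits the points of a list in order. -/
def pathEdges : List Plane → Set (Sym2 Plane)
  | [] => ∅
  | [_] => ∅
  | a :: b :: l => insert s(a, b) (pathEdges (b :: l))

/-- Two segments cross: they have no common end point, and they meet. (For two edges of a diagram
this forces them to meet in exactly one point, which is interior to both, and transversally.) -/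
def Crosses (e f : Sym2 Plane) : Prop :=
  (∀ p ∈ e, p ∉ f) ∧ (seg e ∩ seg f).Nonempty

/-- An (unoriented) virtual knot diagram: a closed polygonal curve in general position in the plane
all of whose double points are marked either as classical crossings, with the information which
of the two strands passes over the other, or as virtual crossings. Since two edges meet at most
once, a crossing is given by the pair of edges that meet there. -/
structure Diagram where
  /-- The edges of the polygon. -/
  edges : Set (Sym2 Plane)
  /-- `isOver e f`: the edges `e` and `f` meet in a classical crossing, where `e` passes over `f`.
  Crossings at which neither edge passes over the other are the virtual ones. -/
  isOver : Sym2 Plane → Sym2 Plane → Prop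
  /-- The edges form one closed polygon `v₀ v₁ … v_k v₀` with distinct vertices, `k ≥ 2`. -/
  closed_polygon : ∃ (v : Plane) (l : List Plane),
    (v :: l).Nodup ∧ 2 ≤ l.length ∧ edges = pathEdges (v :: l ++ [v])
  /-- A vertex lies on no edge except the two that end there. -/
  vertex_generic : ∀ e ∈ edges, ∀ f ∈ edges, ∀ p ∈ e, p ∈ seg f → p ∈ f
  /-- Different edges do not overlap. -/
  edge_generic : ∀ e ∈ edges, ∀ f ∈ edges, e ≠ f → (seg e ∩ seg f).Subsingleton
  /-- There are no triple points. -/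
  no_triple : ∀ e ∈ edges, ∀ f ∈ edges, ∀ g ∈ edges, e ≠ f → f ≠ g → e ≠ g →
    seg e ∩ seg f ∩ seg g = ∅
  over_crosses : ∀ e f, isOver e f → e ∈ edges ∧ f ∈ edges ∧ Crosses e f
  over_asymm : ∀ e f, isOver e f → ¬ isOver f e

namespace Diagram

/-- The underlying plane curve, as a set of points. -/
def support (D : Diagram) : Set Plane := ⋃ e ∈ D.edges, seg e

/-- The set of classical crossings. -/
def classicalCrossings (D : Diagram) : Set Plane :=
  {x | ∃ e f, D.isOver e f ∧ x ∈ seg e ∩ seg f}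

/-- The set of virtual crossings. -/
def virtualCrossings (D : Diagram) : Set Plane :=
  {x | ∃ e ∈ D.edges, ∃ f ∈ D.edges,
    Crosses e f ∧ ¬ D.isOver e f ∧ ¬ D.isOver f e ∧ x ∈ seg e ∩ seg f}

/-- The number of classical crossings. -/
noncomputable def numClassical (D : Diagram) : ℕ := D.classicalCrossings.ncard

/-- The number of all crossings, classical and virtual. -/
noncomputable def numTotal (D : Diagram) : ℕ :=
  D.classicalCrossings.ncard + D.virtualCrossings.ncard

/-- Planar isotopy: an ambient isotopy `H` of the plane carries the curve of `D` to the curve of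
`D'`, classical crossings to classical crossings (hence virtual ones to virtual ones), and, near
each classical crossing, the overpassing strand to the overpassing strand. The polygonal
subdivision of the curves plays no role. -/
def Isotopic (D D' : Diagram) : Prop :=
  ∃ H : I → (Plane ≃ₜ Plane),
    Continuous (fun q : I × Plane => H q.1 q.2) ∧
    H 0 = Homeomorph.refl Plane ∧
    H 1 '' D.support = D'.support ∧
    H 1 '' D.classicalCrossings = D'.classicalCrossings ∧
    ∀ e f, D.isOver e f → ∀ x ∈ seg e ∩ seg f,
      ∃ e' f', D'.isOver e' f' ∧ H 1 x ∈ seg e' ∩ seg f' ∧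
        ∀ᶠ y in 𝓝 x, y ∈ seg e → H 1 y ∈ seg e'

/-- `D'` is obtained from `D` by replacing the arc that runs along the polygonal path `p` by the
polygonal path `p'` with the same end points; the rest of the diagram, with the markings of its
crossings, is unchanged. Nothing is said here about the crossings on the two arcs. -/
structure Reroute (D D' : Diagram) (p p' : List Plane) : Prop where
  nodup : p.Nodup
  nodup' : p'.Nodup
  head_eq : p.head? = p'.head?
  last_eq : p.getLast? = p'.getLast?
  subset : pathEdges p ⊆ D.edges
  subset' : pathEdges p' ⊆ D'.edges
  rest_eq : D.edges \ pathEdges p = D'.edges \ pathEdges p'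
  over_iff : ∀ e ∈ D.edges \ pathEdges p, ∀ f ∈ D.edges \ pathEdges p,
    (D.isOver e f ↔ D'.isOver e f)

/-- Detour move: an arc that has only virtual crossings (possibly none, possibly with itself) is
replaced by any other arc with the same end points that has only virtual crossings. -/
def Detour (D D' : Diagram) : Prop :=
  ∃ p p', Reroute D D' p p' ∧
    (∀ e ∈ pathEdges p, ∀ f, ¬ D.isOver e f ∧ ¬ D.isOver f e) ∧
    (∀ e ∈ pathEdges p', ∀ f, ¬ D'.isOver e f ∧ ¬ D'.isOver f e)

/-- First classical Reidemeister move: a kink `a c d b`, where `ac` and `db` meet in a classical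
crossing, is replaced by the segment `ab`. The rest of the diagram stays away from the kink. -/
def ReidemeisterOne (D D' : Diagram) : Prop :=
  ∃ a b c d, Reroute D D' [a, c, d, b] [a, b] ∧
    (D.isOver s(a, c) s(d, b) ∨ D.isOver s(d, b) s(a, c)) ∧
    ∀ g ∈ D.edges \ pathEdges [a, c, d, b], seg g ∩ convexHull ℝ {a, b, c, d} ⊆ {a, b}

/-- Second classical Reidemeister move: the arc `a c b` passes across an edge `e` and back again,
both times over it or both times under it, and is replaced by the segment `ab`. The rest of the
diagram stays away from the triangle `abc`. -/
def ReidemeisterTwo (D D' : Diagram) : Prop :=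
  ∃ a b c e, Reroute D D' [a, c, b] [a, b] ∧
    ((D.isOver s(a, c) e ∧ D.isOver s(c, b) e) ∨ (D.isOver e s(a, c) ∧ D.isOver e s(c, b))) ∧
    ∀ g ∈ D.edges \ pathEdges [a, c, b], g ≠ e → seg g ∩ convexHull ℝ {a, b, c} ⊆ {a, b}

/-- Third classical Reidemeister move: two edges `e`, `f` have a classical crossing in the triangle
`abc`. A strand running along `a c b`, which passes over both `e` and `f` or under both, is moved
across this crossing to `ab`, where it again passes over both or under both, respectively.
The rest of the diagram stays away from the triangle. -/
def ReidemeisterThree (D D' : Diagram) : Prop :=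
  ∃ a b c e f, Reroute D D' [a, c, b] [a, b] ∧
    e ∉ pathEdges [a, c, b] ∧ f ∉ pathEdges [a, c, b] ∧
    D.isOver e f ∧ (∃ y ∈ convexHull ℝ {a, b, c}, y ∈ seg e ∩ seg f) ∧
    ((D'.isOver s(a, b) e ∧ D'.isOver s(a, b) f ∧
        (D.isOver s(a, c) e ∨ D.isOver s(c, b) e) ∧ (D.isOver s(a, c) f ∨ D.isOver s(c, b) f)) ∨
      (D'.isOver e s(a, b) ∧ D'.isOver f s(a, b) ∧
        (D.isOver e s(a, c) ∨ D.isOver e s(c, b)) ∧ (D.isOver f s(a, c) ∨ D.isOver f s(c, b)))) ∧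
    ∀ g ∈ D.edges \ pathEdges [a, c, b], g ≠ e → g ≠ f →
      seg g ∩ convexHull ℝ {a, b, c} ⊆ {a, b}

/-- One step: a planar isotopy, a classical Reidemeister move or a detour move. -/
def Move (D D' : Diagram) : Prop :=
  Isotopic D D' ∨ ReidemeisterOne D D' ∨ ReidemeisterTwo D D' ∨ ReidemeisterThree D D' ∨
    Detour D D'

/-- Equivalence of diagrams: finitely many steps, each performed in either direction. -/
instance setoid : Setoid Diagram := Relation.EqvGen.setoid Move

end Diagram

/-- A virtual knot: an equivalence class of virtual knot diagrams. -/
def Knot : Type := Quotient Diagram.setoid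

namespace Knot

/-- The classical crossing number: the smallest number of classical crossings of a diagram. -/
noncomputable def classicalCrossingNumber (K : Knot) : ℕ :=
  sInf {n | ∃ D : Diagram, (Quotient.mk Diagram.setoid D : Knot) = K ∧ D.numClassical = n}

/-- The total crossing number: the smallest number of all crossings of a diagram. -/
noncomputable def totalCrossingNumber (K : Knot) : ℕ :=
  sInf {n | ∃ D : Diagram, (Quotient.mk Diagram.setoid D : Knot) = K ∧ D.numTotal = n}

end Knot

/-- A polygonal path has finitely many edges. -/
theorem pathEdges_finite (l : List Plane) : (pathEdges l).Finite := by
  induction l with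
  | nil => exact Set.finite_empty
  | cons a l ih =>
    cases l with
    | nil => exact Set.finite_empty
    | cons b l => exact ih.insert _

theorem Diagram.edges_finite (D : Diagram) : D.edges.Finite := by
  obtain ⟨v, l, -, -, h⟩ := D.closed_polygon
  rw [h]
  exact pathEdges_finite _

theorem Crosses.ne {e f : Sym2 Plane} (h : Crosses e f) : e ≠ f := by
  rintro rfl
  induction e using Sym2.ind with
  | _ a b => exact h.1 a (Sym2.mem_mk_left a b) (Sym2.mem_mk_left a b)

theorem Diagram.crossings_finite (D : Diagram) :
    {x | ∃ e ∈ D.edges, ∃ f ∈ D.edges, Crosses e f ∧ x ∈ seg e ∩ seg f}.Finite := by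
  have h : (⋃ e ∈ D.edges, ⋃ f ∈ D.edges, {x | Crosses e f ∧ x ∈ seg e ∩ seg f}).Finite := by
    refine D.edges_finite.biUnion fun e he => D.edges_finite.biUnion fun f hf => ?_
    refine Set.Subsingleton.finite fun x hx y hy => ?_
    exact D.edge_generic e he f hf hx.1.ne hx.2 hy.2
  refine h.subset ?_
  rintro x ⟨e, he, f, hf, hx⟩
  simp only [Set.mem_iUnion]
  exact ⟨e, he, f, hf, hx⟩

/-- The set of classical crossings is finite, so that `ncard` really counts its elements. -/
theorem Diagram.classicalCrossings_finite (D : Diagram) : D.classicalCrossings.Finite := by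
  refine D.crossings_finite.subset ?_
  rintro x ⟨e, f, h, hx⟩
  obtain ⟨he, hf, hc⟩ := D.over_crosses e f h
  exact ⟨e, he, f, hf, hc, hx⟩

/-- The set of virtual crossings is finite, so that `ncard` really counts its elements. -/
theorem Diagram.virtualCrossings_finite (D : Diagram) : D.virtualCrossings.Finite := by
  refine D.crossings_finite.subset ?_
  rintro x ⟨e, he, f, hf, hc, -, -, hx⟩
  exact ⟨e, he, f, hf, hc, hx⟩

end VirtualKnot

/-! Call an edge classical if it carries a classical crossing. If every classical edge carries just
one, then a diagram with `n` classical crossings has `2n` classical edges. The arcs between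
consecutive classical edges have only virtual crossings, so detour moves can straighten each of them
to a single segment. Two segments in general position meet at most once, and counting pairs of edges
gives the bound.

To reach such a diagram, `exists_separated` subdivides the edges until crossings lie in disjoint
parallel strips, and then applies a piecewise linear shear, which is an ambient isotopy, so that no
two classical edges are parallel. In the resulting separated diagram two classical edges never share
an end point and meet only in a classical crossing. Non-parallelism serves `exists_generic_chord`:
the ends of two consecutive classical edges can be trimmed so that the chord between the new ends is
in general position. A detour move along this chord (`exists_detour`, `exists_shorter`) removes an
arc of at least two edges at the cost of one edge. Hence a separated representative with the fewest
edges has no two consecutive non-classical edges (`exists_shorter_of_adjacent`), and so at most `2n`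
non-classical ones.

No virtual crossing of this diagram lies on two classical edges. Two non-classical edges account for
at most `(2n choose 2) = n(2n-1)` virtual crossings. A non-classical edge shares an end point with
the classical edge after it and so crosses at most `2n-1` classical edges, which gives at most
`2n(2n-1)` more. The total is `n + 3n(2n-1) = 6n² - 2n`. The straightening needs some classical
edge; for `n = 0` the whole diagram is instead detoured to a triangle (`exists_numTotal_eq_zero`).
-/

namespace VirtualKnot

/-! ### Plane geometry: collinearity, segments, generic points. -/

/-- The determinant of two plane vectors. -/
def cross (u v : Plane) : ℝ := u.1 * v.2 - u.2 * v.1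

/-- Twice the signed area of the triangle `abc`; it vanishes iff the points are collinear. -/
def side (a b c : Plane) : ℝ := cross (b - a) (c - a)

theorem side_lineMap (a b c d : Plane) (t : ℝ) :
    side a b (AffineMap.lineMap c d t) = (1 - t) * side a b c + t * side a b d := by
  simp only [side, cross, AffineMap.lineMap_apply, vsub_eq_sub, vadd_eq_add, Prod.fst_sub,
    Prod.snd_sub, Prod.fst_add, Prod.snd_add, Prod.smul_fst, Prod.smul_snd, smul_eq_mul]
  ring

@[simp] theorem side_left (a b : Plane) : side a b a = 0 := by simp [side, cross]

@[simp] theorem side_right (a b : Plane) : side a b b = 0 := by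
  simp only [side, cross]; ring

@[simp] theorem side_self (a c : Plane) : side a a c = 0 := by simp [side, cross]

theorem side_rotate (a b c : Plane) : side a b c = side b c a := by
  simp only [side, cross, Prod.fst_sub, Prod.snd_sub]; ring

/-- Three points on the line through two different points are collinear. -/
theorem side_eq_zero_of_line {u v a b c : Plane} (h : u ≠ v) (ha : side u v a = 0)
    (hb : side u v b = 0) (hc : side u v c = 0) : side a b c = 0 := by
  -- Scaling by each coordinate of `v - u` avoids a case distinction on the slope of the line; one
  -- of the two coordinates is nonzero.
  have key : (v.1 - u.1) * side a b c = 0 ∧ (v.2 - u.2) * side a b c = 0 := by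
    simp only [side, cross, Prod.fst_sub, Prod.snd_sub] at *
    constructor
    · linear_combination (c.1 - b.1) * ha + (a.1 - c.1) * hb + (b.1 - a.1) * hc
    · linear_combination (c.2 - b.2) * ha + (a.2 - c.2) * hb + (b.2 - a.2) * hc
  by_contra hne
  apply h
  have h1 := (mul_eq_zero.1 key.1).resolve_right hne
  have h2 := (mul_eq_zero.1 key.2).resolve_right hne
  exact Prod.ext (by linarith) (by linarith)

theorem seg_mk (a b : Plane) : seg s(a, b) = segment ℝ a b := by
  rw [seg, ← convexHull_pair]
  congr 1
  ext p
  simp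

theorem mem_seg_iff {a b x : Plane} :
    x ∈ seg s(a, b) ↔ ∃ t ∈ Set.Icc (0 : ℝ) 1, AffineMap.lineMap a b t = x := by
  rw [seg_mk, segment_eq_image_lineMap]; rfl

theorem mem_seg_of_mem {e : Sym2 Plane} {p : Plane} (h : p ∈ e) : p ∈ seg e :=
  subset_convexHull ℝ _ h

theorem convex_seg (e : Sym2 Plane) : Convex ℝ (seg e) := convex_convexHull ℝ _

theorem isClosed_seg (e : Sym2 Plane) : IsClosed (seg e) := by
  induction e using Sym2.ind with
  | _ a b =>
    rw [seg_mk, segment_eq_image_lineMap]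
    exact (isCompact_Icc.image AffineMap.lineMap_continuous).isClosed

theorem seg_subset {e : Sym2 Plane} {a b : Plane} (ha : a ∈ seg e) (hb : b ∈ seg e) :
    seg s(a, b) ⊆ seg e := by
  rw [seg_mk]
  exact (convex_seg e).segment_subset ha hb

theorem side_of_mem_seg {a b x : Plane} (h : x ∈ seg s(a, b)) : side a b x = 0 := by
  obtain ⟨t, -, rfl⟩ := mem_seg_iff.1 h
  simp [side_lineMap]

theorem lineMap_injective' {a b : Plane} (h : a ≠ b) :
    Function.Injective (fun t : ℝ => (AffineMap.lineMap a b t : Plane)) :=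
  AffineMap.lineMap_injective ℝ h

/-- If a line meets the line `cd` in two points of the segment `cd`, then it contains `c`
and `d`. -/
theorem side_eq_zero_of_two {u v c d x y : Plane} (hx : x ∈ seg s(c, d)) (hy : y ∈ seg s(c, d))
    (hxy : x ≠ y) (h1 : side u v x = 0) (h2 : side u v y = 0) :
    side u v c = 0 ∧ side u v d = 0 := by
  obtain ⟨t, -, rfl⟩ := mem_seg_iff.1 hx
  obtain ⟨s, -, rfl⟩ := mem_seg_iff.1 hy
  have hts : t - s ≠ 0 := fun h => hxy (by rw [sub_eq_zero.1 h])
  rw [side_lineMap] at h1 h2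
  constructor
  · exact mul_left_cancel₀ hts (by linear_combination (-s) * h1 + t * h2)
  · exact mul_left_cancel₀ hts (by linear_combination (1 - s) * h1 - (1 - t) * h2)

theorem openSegment_infinite {x y : Plane} (h : x ≠ y) : (openSegment ℝ x y).Infinite := by
  rw [openSegment_eq_image_lineMap]
  exact (Set.Ioo_infinite one_pos).image (lineMap_injective' h).injOn

/-- An open segment contains a point that avoids finitely many points and finitely many lines,
none of which contains the segment. -/
theorem exists_mem_openSegment {x y : Plane} (h : x ≠ y) {F : Set Plane} (hF : F.Finite)
    {S : Set (Plane × Plane)} (hS : S.Finite)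
    (hne : ∀ s ∈ S, side s.1 s.2 x ≠ 0 ∨ side s.1 s.2 y ≠ 0) :
    ∃ c ∈ openSegment ℝ x y, c ∉ F ∧ ∀ s ∈ S, side s.1 s.2 c ≠ 0 := by
  have hfin : (F ∪ ⋃ s ∈ S, {c | c ∈ openSegment ℝ x y ∧ side s.1 s.2 c = 0}).Finite := by
    refine hF.union (hS.biUnion fun s hs => Set.Subsingleton.finite ?_)
    -- Each line excludes at most one point: two common points would put the whole segment on the
    -- line.
    rintro c ⟨hc, hc0⟩ d ⟨hd, hd0⟩
    by_contra hcd
    have hc' : c ∈ seg s(x, y) := seg_mk x y ▸ openSegment_subset_segment ℝ x y hc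
    have hd' : d ∈ seg s(x, y) := seg_mk x y ▸ openSegment_subset_segment ℝ x y hd
    have := side_eq_zero_of_two hc' hd' hcd hc0 hd0
    have := hne s hs
    tauto
  obtain ⟨c, hc, hcn⟩ := ((openSegment_infinite h).sdiff hfin).nonempty
  refine ⟨c, hc, fun hcF => hcn (Or.inl hcF), fun s hs h0 => hcn (Or.inr ?_)⟩
  simp only [Set.mem_iUnion]
  exact ⟨s, hs, hc, h0⟩

/-! ### Polygonal paths and closed polygons -/

theorem pathEdges_append (l₁ l₂ : List Plane) (a : Plane) :
    pathEdges (l₁ ++ a :: l₂) = pathEdges (l₁ ++ [a]) ∪ pathEdges (a :: l₂) := by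
  induction l₁ with
  | nil => simp [pathEdges]
  | cons b l₁ ih =>
    cases l₁ with
    | nil => simp [pathEdges]
    | cons c l₁ =>
      simp only [List.cons_append, pathEdges] at ih ⊢
      rw [ih, Set.insert_union]

theorem mem_of_mem_pathEdges {l : List Plane} {e : Sym2 Plane} (he : e ∈ pathEdges l) {p : Plane}
    (hp : p ∈ e) : p ∈ l := by
  induction l with
  | nil => simp [pathEdges] at he
  | cons a l ih =>
    cases l with
    | nil => simp [pathEdges] at he
    | cons b l =>
      rcases he with rfl | he
      · rcases Sym2.mem_iff.1 hp with rfl | rfl <;> simp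
      · exact List.mem_cons_of_mem _ (ih he)

/-- The edges of the closed polygon with the given vertices. -/
def closedEdges (L : List Plane) : Set (Sym2 Plane) := pathEdges (L ++ L.take 1)

theorem closedEdges_cons (a : Plane) (L : List Plane) :
    closedEdges (a :: L) = pathEdges (a :: L ++ [a]) := by simp [closedEdges]

/-- A closed polygon may be cut open at any vertex. This is what allows an arc of interest to be
moved to the front of the vertex list. -/
theorem closedEdges_append_comm (A B : List Plane) :
    closedEdges (A ++ B) = closedEdges (B ++ A) := by
  cases A with
  | nil => simp
  | cons a A =>
    cases B with
    | nil => simp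
    | cons b B =>
      have h1 : closedEdges (a :: A ++ b :: B) = pathEdges ((a :: A) ++ b :: (B ++ [a])) := by
        simp [closedEdges]
      have h2 : closedEdges (b :: B ++ a :: A) = pathEdges ((b :: B) ++ a :: (A ++ [b])) := by
        simp [closedEdges]
      rw [h1, h2, pathEdges_append (a :: A), pathEdges_append (b :: B), Set.union_comm]
      simp

theorem pathEdges_eq (l : List Plane) :
    pathEdges l = {e | ∃ (i : ℕ) (h : i + 1 < l.length), e = s(l[i], l[i + 1])} := by
  induction l with
  | nil => simp [pathEdges]
  | cons a l ih =>
    cases l with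
    | nil => simp [pathEdges]
    | cons b l =>
      rw [pathEdges, ih]
      ext e
      simp only [Set.mem_insert_iff, Set.mem_ofPred_eq]
      constructor
      · rintro (rfl | ⟨i, h, rfl⟩)
        · exact ⟨0, by simp, by simp⟩
        · exact ⟨i + 1, by simpa using h, by simp⟩
      · rintro ⟨i, h, rfl⟩
        cases i with
        | zero => left; simp
        | succ i => right; exact ⟨i, by simpa using h, by simp⟩

/-- The `i`-th vertex of a closed polygon, with indices taken modulo the length. -/
def vertexAt (L : List Plane) (i : ℕ) : Plane := L.getD (i % L.length) 0

/-- The `i`-th edge of a closed polygon, with indices taken modulo the length. -/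
def edgeAt (L : List Plane) (i : ℕ) : Sym2 Plane := s(vertexAt L i, vertexAt L (i + 1))

theorem vertexAt_add_length (L : List Plane) (i : ℕ) :
    vertexAt L (i + L.length) = vertexAt L i := by simp [vertexAt]

theorem edgeAt_add_length (L : List Plane) (i : ℕ) :
    edgeAt L (i + L.length) = edgeAt L i := by
  rw [edgeAt, edgeAt, vertexAt_add_length, add_right_comm, vertexAt_add_length]

theorem vertexAt_of_lt {L : List Plane} {i : ℕ} (h : i < L.length) : vertexAt L i = L[i] := by
  simp [vertexAt, Nat.mod_eq_of_lt h, h]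

theorem vertexAt_mod (L : List Plane) (i : ℕ) : vertexAt L (i % L.length) = vertexAt L i := by
  simp [vertexAt]

theorem edgeAt_mod (L : List Plane) (i : ℕ) : edgeAt L (i % L.length) = edgeAt L i := by
  rw [edgeAt, edgeAt, vertexAt_mod, ← vertexAt_mod L (i % L.length + 1), Nat.mod_add_mod,
    vertexAt_mod]

theorem mem_closedEdges {L : List Plane} {e : Sym2 Plane} :
    e ∈ closedEdges L ↔ ∃ i < L.length, e = edgeAt L i := by
  cases L with
  | nil => simp [closedEdges, pathEdges]
  | cons a L =>
    rw [closedEdges_cons, pathEdges_eq]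
    simp only [Set.mem_ofPred_eq, List.length_append, List.length_singleton]
    have key : ∀ i (h : i < (a :: L).length),
        s((a :: L ++ [a])[i]'(by simp at h ⊢; omega), (a :: L ++ [a])[i + 1]'(by simp at h ⊢; omega))
          = edgeAt (a :: L) i := by
      intro i h
      have h1 : (a :: L ++ [a])[i]'(by simp at h ⊢; omega) = vertexAt (a :: L) i := by
        rw [vertexAt_of_lt h, List.getElem_append_left h]
      have h2 : (a :: L ++ [a])[i + 1]'(by simp at h ⊢; omega) = vertexAt (a :: L) (i + 1) := by
        by_cases h' : i + 1 < (a :: L).length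
        · rw [vertexAt_of_lt h', List.getElem_append_left h']
        · have h'' : i + 1 = (a :: L).length := by omega
          rw [List.getElem_append_right (by omega), vertexAt]
          simp [h'']
      rw [edgeAt, h1, h2]
    constructor
    · rintro ⟨i, h, rfl⟩
      exact ⟨i, by omega, key i (by omega)⟩
    · rintro ⟨i, h, rfl⟩
      exact ⟨i, by omega, (key i (by omega)).symm⟩

theorem edgeAt_mem {L : List Plane} (h : L ≠ []) (i : ℕ) : edgeAt L i ∈ closedEdges L :=
  mem_closedEdges.2 ⟨i % L.length, Nat.mod_lt _ (List.length_pos_of_ne_nil h),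
    (edgeAt_mod L i).symm⟩

theorem vertexAt_inj {L : List Plane} (hL : L.Nodup) (h : L ≠ []) {i j : ℕ}
    (hij : vertexAt L i = vertexAt L j) : i % L.length = j % L.length := by
  have hpos := List.length_pos_of_ne_nil h
  have hi := Nat.mod_lt i hpos
  have hj := Nat.mod_lt j hpos
  rw [← vertexAt_mod L i, ← vertexAt_mod L j, vertexAt_of_lt hi, vertexAt_of_lt hj] at hij
  exact (List.Nodup.getElem_inj_iff hL).1 hij

/-- Edges are unordered, so the danger is a match with reversed ends. That would give `i ≡ j + 1`
and `j ≡ i + 1`, so the length would divide 2; a polygon with two vertices does run twice along the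
same edge. -/
theorem edgeAt_inj {L : List Plane} (hL : L.Nodup) (h : 3 ≤ L.length) {i j : ℕ}
    (hi : i < L.length) (hj : j < L.length) (hij : edgeAt L i = edgeAt L j) : i = j := by
  have hne : L ≠ [] := by rintro rfl; simp at h
  rcases Sym2.eq_iff.1 hij with ⟨h1, -⟩ | ⟨h1, h2⟩
  · have := vertexAt_inj hL hne h1
    rwa [Nat.mod_eq_of_lt hi, Nat.mod_eq_of_lt hj] at this
  · have h1 := vertexAt_inj hL hne h1
    have h2 := vertexAt_inj hL hne h2
    rw [Nat.mod_eq_of_lt hi] at h1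
    rw [Nat.mod_eq_of_lt hj] at h2
    by_cases hj' : j + 1 < L.length
    · rw [Nat.mod_eq_of_lt hj'] at h1
      by_cases hi' : i + 1 < L.length
      · rw [Nat.mod_eq_of_lt hi'] at h2; omega
      · have : i + 1 = L.length := by omega
        rw [this, Nat.mod_self] at h2; omega
    · have hj' : j + 1 = L.length := by omega
      rw [hj', Nat.mod_self] at h1
      subst h1
      rw [Nat.mod_eq_of_lt (by omega)] at h2
      omega

theorem closedEdges_ncard {L : List Plane} (hL : L.Nodup) (h : 3 ≤ L.length) :
    (closedEdges L).ncard = L.length := by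
  have : closedEdges L = (fun i => edgeAt L i) '' (Finset.range L.length : Set ℕ) := by
    ext e
    rw [mem_closedEdges]
    simp [eq_comm]
  rw [this, Set.InjOn.ncard_image, Set.ncard_coe_finset, Finset.card_range]
  intro i hi j hj hij
  simp only [Finset.coe_range, Set.mem_Iio] at hi hj
  exact edgeAt_inj hL h hi hj hij

theorem edgeAt_zero (a b : Plane) (L : List Plane) : edgeAt (a :: b :: L) 0 = s(a, b) := by
  rw [edgeAt, vertexAt_of_lt (by simp), vertexAt_of_lt (by simp)]
  simp

theorem edgeAt_one (a b c : Plane) (L : List Plane) : edgeAt (a :: b :: c :: L) 1 = s(b, c) := by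
  rw [edgeAt, vertexAt_of_lt (by simp), vertexAt_of_lt (by simp)]
  simp

/-- Every edge of a closed polygon has different end points. -/
theorem ne_of_mem_closedEdges {L : List Plane} (hL : L.Nodup) (h : 2 ≤ L.length) {a b : Plane}
    (hab : s(a, b) ∈ closedEdges L) : a ≠ b := by
  obtain ⟨i, hi, he⟩ := mem_closedEdges.1 hab
  have hd : ¬ (edgeAt L i).IsDiag := by
    rw [edgeAt, Sym2.mk_isDiag_iff]
    intro h1
    have h1 := vertexAt_inj hL (by rintro rfl; simp at h) h1
    rw [Nat.mod_eq_of_lt hi] at h1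
    by_cases hi' : i + 1 < L.length
    · rw [Nat.mod_eq_of_lt hi'] at h1; omega
    · have : i + 1 = L.length := by omega
      rw [this, Nat.mod_self] at h1; omega
  rw [← he, Sym2.mk_isDiag_iff] at hd
  exact hd

/-! ### Vertices and crossings of a diagram; transversality. -/

namespace Diagram

theorem exists_list (D : Diagram) :
    ∃ L : List Plane, L.Nodup ∧ 3 ≤ L.length ∧ D.edges = closedEdges L := by
  obtain ⟨v, l, h1, h2, h3⟩ := D.closed_polygon
  exact ⟨v :: l, h1, by simpa using h2, by rw [h3, closedEdges_cons]⟩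

theorem ne_of_mem (D : Diagram) {a b : Plane} (h : s(a, b) ∈ D.edges) : a ≠ b := by
  obtain ⟨L, h1, h2, h3⟩ := D.exists_list
  exact ne_of_mem_closedEdges h1 (by omega) (h3 ▸ h)

/-- The set of all crossings. -/
def crossings (D : Diagram) : Set Plane :=
  {x | ∃ e ∈ D.edges, ∃ f ∈ D.edges, Crosses e f ∧ x ∈ seg e ∩ seg f}

/-- The set of vertices. -/
def vertices (D : Diagram) : Set Plane := {p | ∃ e ∈ D.edges, p ∈ e}

theorem vertices_finite (D : Diagram) : D.vertices.Finite := by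
  have : D.vertices = ⋃ e ∈ D.edges, {p | p ∈ e} := by
    ext p; simp [vertices]
  rw [this]
  refine D.edges_finite.biUnion fun e _ => ?_
  induction e using Sym2.ind with
  | _ a b =>
    refine (Set.toFinite {a, b}).subset ?_
    intro p hp
    simpa using hp

/-- If two different edges have a point in common that is not a vertex, they cross. -/
theorem crosses_of_mem (D : Diagram) {e f : Sym2 Plane} (he : e ∈ D.edges) (hf : f ∈ D.edges)
    (hef : e ≠ f) {x : Plane} (hxe : x ∈ seg e) (hxf : x ∈ seg f) (hx : x ∉ e ∨ x ∉ f) :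
    Crosses e f := by
  refine ⟨fun p hpe hpf => ?_, x, hxe, hxf⟩
  have : p = x := D.edge_generic e he f hf hef ⟨mem_seg_of_mem hpe, mem_seg_of_mem hpf⟩ ⟨hxe, hxf⟩
  subst this
  tauto

/-- By `vertex_generic`, a vertex located at a crossing would be a common end point of both crossing
edges. -/
theorem notMem_of_crosses (D : Diagram) {e f : Sym2 Plane} (he : e ∈ D.edges) (hf : f ∈ D.edges)
    (h : Crosses e f) {x : Plane} (hxe : x ∈ seg e) (hxf : x ∈ seg f) {g : Sym2 Plane}
    (hg : g ∈ D.edges) : x ∉ g := fun hx =>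
  h.1 x (D.vertex_generic g hg e he x hx hxe) (D.vertex_generic g hg f hf x hx hxf)

/-- Different edges have different segments, even up to inclusion. -/
theorem eq_of_seg_subset (D : Diagram) {e f : Sym2 Plane} (he : e ∈ D.edges) (hf : f ∈ D.edges)
    {a b : Plane} (hab : a ≠ b) (h1 : seg s(a, b) ⊆ seg e) (h2 : seg s(a, b) ⊆ seg f) : e = f := by
  by_contra hef
  have ha : a ∈ seg s(a, b) := mem_seg_of_mem (by simp)
  have hb : b ∈ seg s(a, b) := mem_seg_of_mem (by simp)
  exact hab (D.edge_generic e he f hf hef ⟨h1 ha, h2 ha⟩ ⟨h1 hb, h2 hb⟩)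

theorem _root_.VirtualKnot.Crosses.symm {e f : Sym2 Plane} (h : Crosses e f) : Crosses f e :=
  ⟨fun p hp hq => h.1 p hq hp, by rw [Set.inter_comm]; exact h.2⟩

/-- Crossing edges are not parallel. -/
theorem cross_ne_zero (D : Diagram) {a b c d : Plane} (he : s(a, b) ∈ D.edges)
    (hf : s(c, d) ∈ D.edges) (h : Crosses s(a, b) s(c, d)) : cross (b - a) (d - c) ≠ 0 := by
  intro h0
  obtain ⟨z, hz1, hz2⟩ := h.2
  have hab := D.ne_of_mem he
  have hcd := D.ne_of_mem hf
  -- all four points are on one line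
  obtain ⟨t, ⟨ht0, ht1⟩, rfl⟩ := mem_seg_iff.1 hz1
  obtain ⟨s, ⟨hs0, hs1⟩, hs⟩ := mem_seg_iff.1 hz2
  obtain ⟨k, hk⟩ : ∃ k : ℝ, d - c = k • (b - a) := by
    simp only [cross] at h0
    by_cases h1 : (b - a).1 = 0
    · have h2 : (b - a).2 ≠ 0 := by
        intro h2
        exact hab (sub_eq_zero.1 (Prod.ext h1 h2)).symm
      refine ⟨(d - c).2 / (b - a).2, Prod.ext ?_ ?_⟩
      · rw [h1, zero_mul, zero_sub, neg_eq_zero] at h0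
        simp [h1, (mul_eq_zero.1 h0).resolve_left h2]
      · simp only [Prod.smul_snd, smul_eq_mul]
        field_simp
    · refine ⟨(d - c).1 / (b - a).1, Prod.ext ?_ ?_⟩
      · simp only [Prod.smul_fst, smul_eq_mul]
        field_simp
      · simp only [Prod.smul_snd, smul_eq_mul]
        field_simp
        linear_combination h0
  -- parameters of `c` and `d` on the line `ab`
  have hc : AffineMap.lineMap a b (t - s * k) = c := by
    have := hs
    simp only [AffineMap.lineMap_apply, vsub_eq_sub, vadd_eq_add, hk] at this ⊢
    rw [sub_smul, mul_smul]
    rw [← eq_sub_iff_add_eq'] at this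
    rw [this]; abel
  have hd : AffineMap.lineMap a b (t + (1 - s) * k) = d := by
    have h1 : d = c + k • (b - a) := by rw [← hk]; abel
    rw [h1, ← hc]
    simp only [AffineMap.lineMap_apply, vsub_eq_sub, vadd_eq_add]
    module
  -- On the line `ab`, parametrised so that the segment is `[0, 1]`, the edge `cd` covers an
  -- interval that contains `t`, and `vertex_generic` keeps its ends out of `[0, 1]`. The interval
  -- therefore contains `0`, which places the vertex `a` on `cd`. The sign of `k` decides which end
  -- is below `0`.
  have hnc : ¬ (0 ≤ t - s * k ∧ t - s * k ≤ 1) := fun hh => by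
    have : c ∈ seg s(a, b) := mem_seg_iff.2 ⟨_, hh, hc⟩
    have := D.vertex_generic _ hf _ he c (by simp) this
    exact h.1 c this (by simp)
  have hnd : ¬ (0 ≤ t + (1 - s) * k ∧ t + (1 - s) * k ≤ 1) := fun hh => by
    have : d ∈ seg s(a, b) := mem_seg_iff.2 ⟨_, hh, hd⟩
    have := D.vertex_generic _ hf _ he d (by simp) this
    exact h.1 d this (by simp)
  have hna : ∀ r, 0 ≤ r → r ≤ 1 → t - s * k + r * k ≠ 0 := fun r hr0 hr1 hr => by
    have : a ∈ seg s(c, d) := by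
      refine mem_seg_iff.2 ⟨r, ⟨hr0, hr1⟩, ?_⟩
      rw [AffineMap.lineMap_apply, vsub_eq_sub, vadd_eq_add, hk, ← hc]
      simp only [AffineMap.lineMap_apply, vsub_eq_sub, vadd_eq_add]
      have h2 : r * k = -(t - s * k) := by linarith
      rw [← mul_smul, h2]
      module
    have := D.vertex_generic _ he _ hf a (by simp) this
    exact h.1 a (by simp) this
  have hk0 : k ≠ 0 := by
    rintro rfl
    rw [zero_smul] at hk
    exact hcd (sub_eq_zero.1 hk).symm
  rcases lt_or_gt_of_ne hk0 with hk | hk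
  · have h1 : s * k ≤ 0 := mul_nonpos_of_nonneg_of_nonpos hs0 hk.le
    have h2 : (1 - s) * k ≤ 0 := mul_nonpos_of_nonneg_of_nonpos (by linarith) hk.le
    have h3 : t + (1 - s) * k < 0 := by
      by_contra h4
      exact hnd ⟨by linarith, by linarith⟩
    refine hna (-(t - s * k) / k) ?_ ?_ (by field_simp; ring)
    · exact div_nonneg_of_nonpos (by linarith) hk.le
    · rw [div_le_one_of_neg hk]; linarith
  · have h1 : 0 ≤ s * k := mul_nonneg hs0 hk.le
    have h2 : 0 ≤ (1 - s) * k := mul_nonneg (by linarith) hk.le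
    have h3 : t - s * k < 0 := by
      by_contra h4
      exact hnc ⟨by linarith, by linarith⟩
    refine hna (-(t - s * k) / k) ?_ ?_ (by field_simp; ring)
    · exact div_nonneg (by linarith) hk.le
    · rw [div_le_one hk]; linarith

end Diagram
end VirtualKnot

/-! ### Inserting a vertex in an edge. -/

namespace VirtualKnot

theorem seg_split {a b c : Plane} (hab : a ≠ b) (hc : c ∈ openSegment ℝ a b) :
    seg s(a, c) ∪ seg s(c, b) = seg s(a, b) ∧ seg s(a, c) ∩ seg s(c, b) = {c} ∧
      a ∉ seg s(c, b) ∧ b ∉ seg s(a, c) := by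
  rw [openSegment_eq_image_lineMap] at hc
  obtain ⟨t, ⟨ht0, ht1⟩, rfl⟩ := hc
  have h1 : ∀ x, x ∈ seg s(a, AffineMap.lineMap a b t) ↔
      ∃ r, (0 ≤ r ∧ r ≤ t) ∧ AffineMap.lineMap a b r = x := by
    intro x
    rw [mem_seg_iff]
    constructor
    · rintro ⟨s, ⟨hs0, hs1⟩, rfl⟩
      refine ⟨s * t, ⟨by positivity, by nlinarith⟩, ?_⟩
      simp only [AffineMap.lineMap_apply, vsub_eq_sub, vadd_eq_add]
      module
    · rintro ⟨r, ⟨hr0, hr1⟩, rfl⟩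
      refine ⟨r / t, ⟨by positivity, (div_le_one ht0).2 hr1⟩, ?_⟩
      have : r = r / t * t := by field_simp
      conv_rhs => rw [this]
      simp only [AffineMap.lineMap_apply, vsub_eq_sub, vadd_eq_add]
      module
  have h2 : ∀ x, x ∈ seg s(AffineMap.lineMap a b t, b) ↔
      ∃ r, (t ≤ r ∧ r ≤ 1) ∧ AffineMap.lineMap a b r = x := by
    intro x
    rw [mem_seg_iff]
    constructor
    · rintro ⟨s, ⟨hs0, hs1⟩, rfl⟩
      refine ⟨t + s * (1 - t), ⟨by nlinarith, by nlinarith⟩, ?_⟩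
      simp only [AffineMap.lineMap_apply, vsub_eq_sub, vadd_eq_add]
      module
    · rintro ⟨r, ⟨hr0, hr1⟩, rfl⟩
      have h3 : 0 < 1 - t := by linarith
      refine ⟨(r - t) / (1 - t), ⟨div_nonneg (by linarith) h3.le,
        (div_le_one h3).2 (by linarith)⟩, ?_⟩
      have : r = t + (r - t) / (1 - t) * (1 - t) := by field_simp; ring
      conv_rhs => rw [this]
      simp only [AffineMap.lineMap_apply, vsub_eq_sub, vadd_eq_add]
      module
  have hinj := lineMap_injective' hab
  refine ⟨?_, ?_, ?_, ?_⟩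
  · ext x
    rw [Set.mem_union, h1, h2, mem_seg_iff]
    constructor
    · rintro (⟨r, ⟨h3, h4⟩, rfl⟩ | ⟨r, ⟨h3, h4⟩, rfl⟩)
      · exact ⟨r, ⟨h3, by linarith⟩, rfl⟩
      · exact ⟨r, ⟨by linarith, h4⟩, rfl⟩
    · rintro ⟨r, ⟨h3, h4⟩, rfl⟩
      rcases le_total r t with h5 | h5
      · exact Or.inl ⟨r, ⟨h3, h5⟩, rfl⟩
      · exact Or.inr ⟨r, ⟨h5, h4⟩, rfl⟩
  · ext x
    rw [Set.mem_inter_iff, h1, h2, Set.mem_singleton_iff]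
    constructor
    · rintro ⟨⟨r, ⟨h3, h4⟩, rfl⟩, ⟨r', ⟨h5, h6⟩, h7⟩⟩
      have := hinj h7
      subst this
      rw [le_antisymm h4 h5]
    · rintro rfl
      exact ⟨⟨t, ⟨ht0.le, le_rfl⟩, rfl⟩, ⟨t, ⟨le_rfl, ht1.le⟩, rfl⟩⟩
  · rw [h2]
    rintro ⟨r, ⟨h3, h4⟩, h5⟩
    have : r = 0 := hinj (h5.trans (AffineMap.lineMap_apply_zero a b).symm)
    linarith
  · rw [h1]
    rintro ⟨r, ⟨h3, h4⟩, h5⟩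
    have : r = 1 := hinj (h5.trans (AffineMap.lineMap_apply_one a b).symm)
    linarith

namespace Diagram

/-- `D₁` arises from `D` by inserting the vertex `c` in the edge `ab`. -/
structure IsInsertion (D D₁ : Diagram) (a b c : Plane) : Prop where
  mem : s(a, b) ∈ D.edges
  mem_open : c ∈ openSegment ℝ a b
  notMem : ∀ g ∈ D.edges, g ≠ s(a, b) → c ∉ seg g
  edges_eq : D₁.edges = insert s(a, c) (insert s(c, b) (D.edges \ {s(a, b)}))
  isOver_iff : ∀ e f, D₁.isOver e f ↔ e ∈ D₁.edges ∧ f ∈ D₁.edges ∧ Crosses e f ∧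
    ∃ e₀ f₀, D.isOver e₀ f₀ ∧ seg e ⊆ seg e₀ ∧ seg f ⊆ seg f₀

/-- With `R` empty the closing edge would be `ab` again, and removing `ab` would remove both
passages. -/
theorem closedEdges_insert {a b c : Plane} {R : List Plane} (hL : (a :: b :: R).Nodup)
    (hR : R ≠ []) : closedEdges (a :: c :: b :: R) =
      insert s(a, c) (insert s(c, b) (closedEdges (a :: b :: R) \ {s(a, b)})) := by
  have h : s(a, b) ∉ pathEdges (b :: (R ++ [a])) := by
    cases R with
    | nil => exact absurd rfl hR
    | cons r R =>
      rintro (h | h)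
      · rcases Sym2.eq_iff.1 h with ⟨rfl, rfl⟩ | ⟨rfl, -⟩ <;> simp at hL
      · have := mem_of_mem_pathEdges h (p := b) (by simp)
        simp at this hL
        tauto
  rw [closedEdges_cons, closedEdges_cons]
  simp only [List.cons_append, pathEdges]
  rw [Set.insert_sdiff_of_mem _ (Set.mem_singleton _), Set.sdiff_singleton_eq_self h]

/-- Every new edge lies in exactly one old edge, its parent, and edges with different parents
inherit general position from them. Edges with the same parent are the two halves of `ab`, which
meet only in `c`, and `c` lies on no other edge. The markings are inherited too, but only by the
half that contains the crossing, so `Crosses` has to be demanded again. -/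
theorem exists_isInsertion (D : Diagram) {a b c : Plane} {R : List Plane}
    (hL : (a :: b :: R).Nodup) (hR : R ≠ []) (hD : D.edges = closedEdges (a :: b :: R))
    (hc : c ∈ openSegment ℝ a b) (hg : ∀ g ∈ D.edges, g ≠ s(a, b) → c ∉ seg g) :
    ∃ D₁, IsInsertion D D₁ a b c ∧ D₁.edges = closedEdges (a :: c :: b :: R) := by
  have hab : a ≠ b := by simp at hL; tauto
  obtain ⟨hu, hi, ha, hb⟩ := seg_split hab hc
  have hmem : s(a, b) ∈ D.edges := by
    rw [hD, closedEdges_cons]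
    simp [pathEdges]
  have hac : seg s(a, c) ⊆ seg s(a, b) := hu ▸ Set.subset_union_left
  have hcb : seg s(c, b) ⊆ seg s(a, b) := hu ▸ Set.subset_union_right
  have hcab : c ∈ seg s(a, b) := hac (mem_seg_of_mem (by simp))
  have hca : c ≠ a := by rintro rfl; exact ha (mem_seg_of_mem (by simp))
  have hcb' : c ≠ b := by rintro rfl; exact hb (mem_seg_of_mem (by simp))
  -- `c` is not a vertex
  have hcv : ∀ g ∈ D.edges, c ∉ g := by
    intro g hgD hcg
    rcases Sym2.mem_iff.1 (D.vertex_generic g hgD _ hmem c hcg hcab) with h | h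
    · exact hca h
    · exact hcb' h
  have hE := closedEdges_insert (c := c) hL hR
  rw [← hD] at hE
  generalize hE₁ : insert s(a, c) (insert s(c, b) (D.edges \ {s(a, b)})) = E₁ at hE
  have hcases : ∀ e ∈ E₁, e = s(a, c) ∨ e = s(c, b) ∨ (e ∈ D.edges ∧ e ≠ s(a, b)) := by
    rw [← hE₁]
    rintro e (h | h | h)
    · exact Or.inl h
    · exact Or.inr (Or.inl h)
    · exact Or.inr (Or.inr h)
  have hpar : ∀ e ∈ E₁, ∃ e₀ ∈ D.edges, seg e ⊆ seg e₀ ∧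
      ((e₀ = s(a, b) ∧ (e = s(a, c) ∨ e = s(c, b))) ∨ e = e₀ ∧ e₀ ≠ s(a, b)) := by
    intro e he
    rcases hcases e he with rfl | rfl | ⟨h1, h2⟩
    · exact ⟨_, hmem, hac, Or.inl ⟨rfl, Or.inl rfl⟩⟩
    · exact ⟨_, hmem, hcb, Or.inl ⟨rfl, Or.inr rfl⟩⟩
    · exact ⟨e, h1, subset_rfl, Or.inr ⟨rfl, h2⟩⟩
  have hvert : ∀ e ∈ E₁, ∀ p ∈ e, p = c ∨ ∃ e₀ ∈ D.edges, p ∈ e₀ := by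
    intro e he p hp
    rcases hcases e he with rfl | rfl | ⟨h1, h2⟩
    · rcases Sym2.mem_iff.1 hp with rfl | rfl
      · exact Or.inr ⟨_, hmem, by simp⟩
      · exact Or.inl rfl
    · rcases Sym2.mem_iff.1 hp with rfl | rfl
      · exact Or.inl rfl
      · exact Or.inr ⟨_, hmem, by simp⟩
    · exact Or.inr ⟨e, h1, hp⟩
  have hvg : ∀ e ∈ E₁, ∀ f ∈ E₁, ∀ p ∈ e, p ∈ seg f → p ∈ f := by
    intro e he f hf p hp hpf
    rcases hvert e he p hp with rfl | ⟨e₀, he₀, hpe₀⟩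
    · rcases hcases f hf with rfl | rfl | ⟨h1, h2⟩
      · simp
      · simp
      · exact absurd hpf (hg f h1 h2)
    · rcases hcases f hf with rfl | rfl | ⟨h1, h2⟩
      · rcases Sym2.mem_iff.1 (D.vertex_generic _ he₀ _ hmem p hpe₀ (hac hpf)) with rfl | rfl
        · simp
        · exact absurd hpf hb
      · rcases Sym2.mem_iff.1 (D.vertex_generic _ he₀ _ hmem p hpe₀ (hcb hpf)) with rfl | rfl
        · exact absurd hpf ha
        · simp
      · exact D.vertex_generic _ he₀ _ h1 p hpe₀ hpf
  have hsame : ∀ e ∈ E₁, ∀ f ∈ E₁, e ≠ f → ∀ e₀, (e₀ = s(a, b) ∧ (e = s(a, c) ∨ e = s(c, b))) ∨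
      e = e₀ ∧ e₀ ≠ s(a, b) → (e₀ = s(a, b) ∧ (f = s(a, c) ∨ f = s(c, b))) ∨
      f = e₀ ∧ e₀ ≠ s(a, b) → e₀ = s(a, b) ∧ seg e ∩ seg f = {c} := by
    intro e he f hf hef e₀ h1 h2
    rcases h1 with ⟨rfl, h1⟩ | ⟨rfl, h1⟩
    · refine ⟨rfl, ?_⟩
      rcases h2 with ⟨-, h2⟩ | ⟨-, h2⟩
      · rcases h1 with rfl | rfl <;> rcases h2 with rfl | rfl
        · exact absurd rfl hef
        · exact hi
        · rw [Set.inter_comm]; exact hi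
        · exact absurd rfl hef
      · exact absurd rfl h2
    · rcases h2 with ⟨rfl, -⟩ | ⟨rfl, -⟩
      · exact absurd rfl h1
      · exact absurd rfl hef
  have heg : ∀ e ∈ E₁, ∀ f ∈ E₁, e ≠ f → (seg e ∩ seg f).Subsingleton := by
    intro e he f hf hef
    obtain ⟨e₀, he₀, hes, h1⟩ := hpar e he
    obtain ⟨f₀, hf₀, hfs, h2⟩ := hpar f hf
    by_cases h : e₀ = f₀
    · subst h
      rw [(hsame e he f hf hef e₀ h1 h2).2]
      exact Set.subsingleton_singleton
    · exact (D.edge_generic e₀ he₀ f₀ hf₀ h).anti (Set.inter_subset_inter hes hfs)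
  have htri : ∀ e ∈ E₁, ∀ f ∈ E₁, ∀ g ∈ E₁, e ≠ f → f ≠ g → e ≠ g → ∀ x, x ∈ seg e → x ∈ seg f →
      x ∈ seg g → ∀ e₀, (e₀ = s(a, b) ∧ (e = s(a, c) ∨ e = s(c, b))) ∨
      e = e₀ ∧ e₀ ≠ s(a, b) → (e₀ = s(a, b) ∧ (f = s(a, c) ∨ f = s(c, b))) ∨
      f = e₀ ∧ e₀ ≠ s(a, b) → False := by
    intro e he f hf g hgE hef hfg heg x hxe hxf hxg e₀ h1 h2
    obtain ⟨rfl, h3⟩ := hsame e he f hf hef e₀ h1 h2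
    have hx : x = c := by
      have : x ∈ seg e ∩ seg f := ⟨hxe, hxf⟩
      rwa [h3] at this
    subst hx
    rcases hcases g hgE with rfl | rfl | ⟨h4, h5⟩
    · rcases h1 with ⟨-, rfl | rfl⟩ | h1
      · exact heg rfl
      · rcases h2 with ⟨-, rfl | rfl⟩ | h2
        · exact hfg rfl
        · exact hef rfl
        · exact h2.2 rfl
      · exact h1.2 rfl
    · rcases h1 with ⟨-, rfl | rfl⟩ | h1
      · rcases h2 with ⟨-, rfl | rfl⟩ | h2
        · exact hef rfl
        · exact hfg rfl
        · exact h2.2 rfl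
      · exact heg rfl
      · exact h1.2 rfl
    · exact hg g h4 h5 hxg
  refine ⟨⟨E₁, fun e f => e ∈ E₁ ∧ f ∈ E₁ ∧ Crosses e f ∧
    ∃ e₀ f₀, D.isOver e₀ f₀ ∧ seg e ⊆ seg e₀ ∧ seg f ⊆ seg f₀, ?_, hvg, heg, ?_, ?_, ?_⟩,
    ⟨hmem, hc, hg, hE₁.symm, fun e f => Iff.rfl⟩, hE.symm⟩
  · refine ⟨a, c :: b :: R, ?_, by simp, by rw [← hE, closedEdges_cons]⟩
    -- Every entry of the list is a vertex, and `c` is not one.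
    have hcR : c ∉ R := by
      intro h
      obtain ⟨i, hi, h⟩ := List.mem_iff_getElem.1 h
      have hlen : i + 2 < (a :: b :: R).length := by simpa using hi
      have h1 : vertexAt (a :: b :: R) (i + 2) = c := by
        rw [vertexAt_of_lt hlen]; simpa using h
      refine hcv (edgeAt (a :: b :: R) (i + 2)) ?_ (by simp [edgeAt, h1])
      rw [hD]
      exact edgeAt_mem (by simp) _
    simp only [List.nodup_cons, List.mem_cons, not_or] at hL ⊢
    exact ⟨⟨hca.symm, hL.1⟩, ⟨hcb', hcR⟩, hL.2⟩
  · intro e he f hf g hgE hef hfg heg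
    rw [Set.eq_empty_iff_forall_notMem]
    rintro x ⟨⟨hxe, hxf⟩, hxg⟩
    obtain ⟨e₀, he₀, hes, h1⟩ := hpar e he
    obtain ⟨f₀, hf₀, hfs, h2⟩ := hpar f hf
    obtain ⟨g₀, hg₀, hgs, h3⟩ := hpar g hgE
    by_cases hef' : e₀ = f₀
    · subst hef'
      exact htri e he f hf g hgE hef hfg heg x hxe hxf hxg _ h1 h2
    by_cases hfg' : f₀ = g₀
    · subst hfg'
      exact htri f hf g hgE e he hfg heg.symm hef.symm x hxf hxg hxe _ h2 h3
    by_cases heg' : e₀ = g₀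
    · subst heg'
      exact htri e he g hgE f hf heg hfg.symm hef x hxe hxg hxf _ h1 h3
    have := D.no_triple e₀ he₀ f₀ hf₀ g₀ hg₀ hef' hfg' heg'
    rw [Set.eq_empty_iff_forall_notMem] at this
    exact this x ⟨⟨hes hxe, hfs hxf⟩, hgs hxg⟩
  · rintro e f ⟨h1, h2, h3, -⟩
    exact ⟨h1, h2, h3⟩
  · have hne : ∀ e ∈ E₁, ∃ u v, u ≠ v ∧ e = s(u, v) := by
      intro e he
      rcases hcases e he with rfl | rfl | ⟨h1, -⟩
      · exact ⟨a, c, hca.symm, rfl⟩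
      · exact ⟨c, b, hcb', rfl⟩
      · induction e using Sym2.ind with
        | _ u v => exact ⟨u, v, D.ne_of_mem h1, rfl⟩
    -- Parents are unique, so opposite markings on the children would be opposite markings on the
    -- same pair of old edges.
    rintro e f ⟨he, hf, -, e₀, f₀, h0, hes, hfs⟩ ⟨-, -, -, f₁, e₁, h1, hfs', hes'⟩
    obtain ⟨u, v, huv, rfl⟩ := hne e he
    obtain ⟨u', v', huv', rfl⟩ := hne f hf
    have h2 := D.over_crosses _ _ h0
    have h3 := D.over_crosses _ _ h1
    obtain rfl := D.eq_of_seg_subset h2.1 h3.2.1 huv hes hes'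
    obtain rfl := D.eq_of_seg_subset h2.2.1 h3.1 huv' hfs hfs'
    exact D.over_asymm _ _ h0 h1

end Diagram
end VirtualKnot

/-! ### Separated diagrams, and their behaviour under insertion. -/

namespace VirtualKnot

/-- The direction of a subsegment is a multiple of the direction of the segment. -/
theorem exists_smul_of_seg_subset {a b u v : Plane} (huv : u ≠ v)
    (h : seg s(u, v) ⊆ seg s(a, b)) : ∃ k : ℝ, k ≠ 0 ∧ v - u = k • (b - a) := by
  obtain ⟨t, -, ht⟩ := mem_seg_iff.1 (h (mem_seg_of_mem (p := u) (by simp)))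
  obtain ⟨s, -, hs⟩ := mem_seg_iff.1 (h (mem_seg_of_mem (p := v) (by simp)))
  have hk : v - u = (s - t) • (b - a) := by
    rw [← ht, ← hs]
    simp only [AffineMap.lineMap_apply, vsub_eq_sub, vadd_eq_add]
    module
  refine ⟨s - t, fun h0 => huv ?_, hk⟩
  rw [h0, zero_smul] at hk
  exact (sub_eq_zero.1 hk).symm

theorem cross_smul_smul (u v : Plane) (k l : ℝ) : cross (k • u) (l • v) = k * l * cross u v := by
  simp only [cross, Prod.smul_fst, Prod.smul_snd, smul_eq_mul]; ring

namespace Diagram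

/-- Two edges meet in a classical crossing. -/
def Linked (D : Diagram) (e f : Sym2 Plane) : Prop := D.isOver e f ∨ D.isOver f e

/-- An edge is classical if there is a classical crossing on it. -/
def IsClassical (D : Diagram) (e : Sym2 Plane) : Prop := ∃ f, D.Linked e f

theorem Linked.symm {D : Diagram} {e f : Sym2 Plane} (h : D.Linked e f) : D.Linked f e := Or.symm h

theorem Linked.mem {D : Diagram} {e f : Sym2 Plane} (h : D.Linked e f) :
    e ∈ D.edges ∧ f ∈ D.edges ∧ Crosses e f := by
  rcases h with h | h
  · exact D.over_crosses _ _ h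
  · have := D.over_crosses _ _ h
    exact ⟨this.2.1, this.1, this.2.2.symm⟩

theorem IsClassical.mem {D : Diagram} {e : Sym2 Plane} (h : D.IsClassical e) : e ∈ D.edges :=
  h.choose_spec.mem.1

theorem mem_classicalCrossings {D : Diagram} {x : Plane} :
    x ∈ D.classicalCrossings ↔ ∃ e f, D.Linked e f ∧ x ∈ seg e ∧ x ∈ seg f := by
  constructor
  · rintro ⟨e, f, h, h1, h2⟩
    exact ⟨e, f, Or.inl h, h1, h2⟩
  · rintro ⟨e, f, h | h, h1, h2⟩
    · exact ⟨e, f, h, h1, h2⟩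
    · exact ⟨f, e, h, h2, h1⟩

/-- A diagram in which the classical crossings are separated from each other: each classical edge
is linked with one other classical edge only and does not meet the remaining ones, and no two
classical edges are parallel. -/
structure Separated (D : Diagram) : Prop where
  linked_unique : ∀ {e f g}, D.Linked e f → D.Linked e g → f = g
  linked_of_crosses : ∀ {e f}, D.IsClassical e → D.IsClassical f → Crosses e f → D.Linked e f
  notMem : ∀ {e f}, D.IsClassical e → D.IsClassical f → e ≠ f → ∀ p ∈ e, p ∉ f
  cross_ne : ∀ {a b c d}, D.IsClassical s(a, b) → D.IsClassical s(c, d) → s(a, b) ≠ s(c, d) →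
    cross (b - a) (d - c) ≠ 0

theorem equiv_of_move {D D' : Diagram} (h : Move D D') : D ≈ D' := Relation.EqvGen.rel _ _ h

namespace IsInsertion

variable {D D₁ : Diagram} {a b c : Plane}

theorem ne (h : IsInsertion D D₁ a b c) : a ≠ b := D.ne_of_mem h.mem

theorem seg_union (h : IsInsertion D D₁ a b c) :
    seg s(a, c) ∪ seg s(c, b) = seg s(a, b) := (seg_split h.ne h.mem_open).1

theorem seg_inter (h : IsInsertion D D₁ a b c) :
    seg s(a, c) ∩ seg s(c, b) = {c} := (seg_split h.ne h.mem_open).2.1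

theorem seg_left (h : IsInsertion D D₁ a b c) : seg s(a, c) ⊆ seg s(a, b) :=
  h.seg_union ▸ Set.subset_union_left

theorem seg_right (h : IsInsertion D D₁ a b c) : seg s(c, b) ⊆ seg s(a, b) :=
  h.seg_union ▸ Set.subset_union_right

theorem mem_left (h : IsInsertion D D₁ a b c) : s(a, c) ∈ D₁.edges := by
  rw [h.edges_eq]; simp

theorem mem_right (h : IsInsertion D D₁ a b c) : s(c, b) ∈ D₁.edges := by
  rw [h.edges_eq]; simp

theorem mem_old (h : IsInsertion D D₁ a b c) {e : Sym2 Plane} (he : e ∈ D.edges)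
    (hne : e ≠ s(a, b)) : e ∈ D₁.edges := by
  rw [h.edges_eq]; simp [he, hne]

theorem cases (h : IsInsertion D D₁ a b c) {e : Sym2 Plane} (he : e ∈ D₁.edges) :
    e = s(a, c) ∨ e = s(c, b) ∨ (e ∈ D.edges ∧ e ≠ s(a, b)) := by
  rw [h.edges_eq] at he
  exact he

theorem exists_parent (h : IsInsertion D D₁ a b c) {e : Sym2 Plane} (he : e ∈ D₁.edges) :
    ∃ e₀ ∈ D.edges, seg e ⊆ seg e₀ := by
  rcases h.cases he with rfl | rfl | ⟨h1, -⟩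
  · exact ⟨_, h.mem, h.seg_left⟩
  · exact ⟨_, h.mem, h.seg_right⟩
  · exact ⟨e, h1, subset_rfl⟩

theorem parent_unique (_ : IsInsertion D D₁ a b c) {e e₀ e₁ : Sym2 Plane} (he : e ∈ D₁.edges)
    (h0 : e₀ ∈ D.edges) (h1 : e₁ ∈ D.edges) (hs0 : seg e ⊆ seg e₀) (hs1 : seg e ⊆ seg e₁) :
    e₀ = e₁ := by
  induction e using Sym2.ind with
  | _ u v => exact D.eq_of_seg_subset h0 h1 (D₁.ne_of_mem he) hs0 hs1

theorem vertices_eq (h : IsInsertion D D₁ a b c) : D₁.vertices = insert c D.vertices := by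
  ext p
  constructor
  · rintro ⟨e, he, hp⟩
    rcases h.cases he with rfl | rfl | ⟨h1, -⟩
    · rcases Sym2.mem_iff.1 hp with rfl | rfl
      · exact Or.inr ⟨_, h.mem, by simp⟩
      · exact Or.inl rfl
    · rcases Sym2.mem_iff.1 hp with rfl | rfl
      · exact Or.inl rfl
      · exact Or.inr ⟨_, h.mem, by simp⟩
    · exact Or.inr ⟨e, h1, hp⟩
  · rintro (rfl | ⟨e, he, hp⟩)
    · exact ⟨_, h.mem_left, by simp⟩
    · by_cases hne : e = s(a, b)
      · subst hne
        rcases Sym2.mem_iff.1 hp with rfl | rfl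
        · exact ⟨_, h.mem_left, by simp⟩
        · exact ⟨_, h.mem_right, by simp⟩
      · exact ⟨e, h.mem_old he hne, hp⟩

/-- Two different edges with the same parent are the two new edges. -/
theorem same_parent (h : IsInsertion D D₁ a b c) {e f e₀ : Sym2 Plane} (he : e ∈ D₁.edges)
    (hf : f ∈ D₁.edges) (hef : e ≠ f) (h0 : e₀ ∈ D.edges) (hse : seg e ⊆ seg e₀)
    (hsf : seg f ⊆ seg e₀) : e₀ = s(a, b) ∧ seg e ∩ seg f = {c} ∧ c ∈ e ∧ c ∈ f := by
  have key : ∀ {e f : Sym2 Plane}, e ∈ D₁.edges → f ∈ D₁.edges → e ≠ f → seg e ⊆ seg e₀ →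
      seg f ⊆ seg e₀ → e ∈ D.edges → e ≠ s(a, b) → False := by
    intro e f he hf hef hse hsf heD hne
    obtain rfl := h.parent_unique he h0 heD hse subset_rfl
    rcases h.cases hf with rfl | rfl | ⟨h3, -⟩
    · exact hne (h.parent_unique hf h0 h.mem hsf h.seg_left)
    · exact hne (h.parent_unique hf h0 h.mem hsf h.seg_right)
    · exact hef (h.parent_unique hf h0 h3 hsf subset_rfl)
  rcases h.cases he with rfl | rfl | ⟨h1, h2⟩
  · refine ⟨h.parent_unique he h0 h.mem hse h.seg_left, ?_⟩
    rcases h.cases hf with rfl | rfl | ⟨h1, h2⟩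
    · exact absurd rfl hef
    · exact ⟨h.seg_inter, by simp, by simp⟩
    · exact (key hf he hef.symm hsf hse h1 h2).elim
  · refine ⟨h.parent_unique he h0 h.mem hse h.seg_right, ?_⟩
    rcases h.cases hf with rfl | rfl | ⟨h1, h2⟩
    · exact ⟨by rw [Set.inter_comm]; exact h.seg_inter, by simp, by simp⟩
    · exact absurd rfl hef
    · exact (key hf he hef.symm hsf hse h1 h2).elim
  · exact (key he hf hef hse hsf h1 h2).elim

/-- Near a point other than `c`, an old edge coincides with one of its halves, because the other
half is closed and misses the point. The local form is what `Isotopic` asks of overpassing strands.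
-/
theorem exists_child (h : IsInsertion D D₁ a b c) {e₀ : Sym2 Plane} (h0 : e₀ ∈ D.edges)
    {x : Plane} (hx : x ∈ seg e₀) : ∃ e ∈ D₁.edges, x ∈ seg e ∧ seg e ⊆ seg e₀ ∧
      (x ≠ c → ∀ᶠ y in 𝓝 x, y ∈ seg e₀ → y ∈ seg e) := by
  by_cases hne : e₀ = s(a, b)
  · subst hne
    have hx' := hx
    rw [← h.seg_union] at hx'
    have key : ∀ {s t : Set Plane}, s ∪ t = seg s(a, b) → s ∩ t = {c} → IsClosed t → x ∈ s →
        x ≠ c → ∀ᶠ y in 𝓝 x, y ∈ seg s(a, b) → y ∈ s := by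
      intro s t hst hi ht hxs hxc
      have hxt : x ∉ t := fun hxt => hxc (by
        have : x ∈ s ∩ t := ⟨hxs, hxt⟩
        rwa [hi] at this)
      filter_upwards [ht.isOpen_compl.mem_nhds hxt] with y hy hys
      rw [← hst] at hys
      exact hys.resolve_right hy
    rcases hx' with hx' | hx'
    · exact ⟨_, h.mem_left, hx', h.seg_left, key h.seg_union h.seg_inter (isClosed_seg _) hx'⟩
    · exact ⟨_, h.mem_right, hx', h.seg_right, key (by rw [Set.union_comm]; exact h.seg_union)
        (by rw [Set.inter_comm]; exact h.seg_inter) (isClosed_seg _) hx'⟩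
  · exact ⟨e₀, h.mem_old h0 hne, hx, subset_rfl, fun _ => by simp⟩

theorem support_eq (h : IsInsertion D D₁ a b c) : D₁.support = D.support := by
  ext x
  simp only [support, Set.mem_iUnion, exists_prop]
  constructor
  · rintro ⟨e, he, hx⟩
    obtain ⟨e₀, h0, hs⟩ := h.exists_parent he
    exact ⟨e₀, h0, hs hx⟩
  · rintro ⟨e, he, hx⟩
    obtain ⟨e', he', hx', -⟩ := h.exists_child he hx
    exact ⟨e', he', hx'⟩

/-- The new vertex lies on one edge only. -/
theorem eq_of_mem (h : IsInsertion D D₁ a b c) {e f : Sym2 Plane} (he : e ∈ D.edges)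
    (hf : f ∈ D.edges) (hce : c ∈ seg e) (hcf : c ∈ seg f) : e = f := by
  have : ∀ {e}, e ∈ D.edges → c ∈ seg e → e = s(a, b) := fun he hce =>
    by_contra fun hne => h.notMem _ he hne hce
  rw [this he hce, this hf hcf]

/-- A common end point would be `c`, which lies on only one old edge, or an old vertex located at a
crossing. -/
theorem crosses_child (h : IsInsertion D D₁ a b c) {e f e₀ f₀ : Sym2 Plane} (he : e ∈ D₁.edges)
    (h0 : e₀ ∈ D.edges) (h0' : f₀ ∈ D.edges)
    (hc : Crosses e₀ f₀) (hse : seg e ⊆ seg e₀) (hsf : seg f ⊆ seg f₀) {x : Plane}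
    (hxe : x ∈ seg e) (hxf : x ∈ seg f) : Crosses e f := by
  refine ⟨fun p hpe hpf => ?_, x, hxe, hxf⟩
  have h1 := hse (mem_seg_of_mem hpe)
  have h2 := hsf (mem_seg_of_mem hpf)
  have hp : p ∈ D₁.vertices := ⟨e, he, hpe⟩
  rw [h.vertices_eq] at hp
  rcases hp with rfl | ⟨g, hg, hp⟩
  · exact hc.ne (h.eq_of_mem h0 h0' h1 h2)
  · exact D.notMem_of_crosses h0 h0' hc h1 h2 hg hp

/-- The parents differ, since two halves of one edge share `c`. The meeting point is no vertex of
`D₁`, hence none of `D`. -/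
theorem crosses_parent (h : IsInsertion D D₁ a b c) {e f e₀ f₀ : Sym2 Plane} (he : e ∈ D₁.edges)
    (hf : f ∈ D₁.edges) (h0 : e₀ ∈ D.edges) (h0' : f₀ ∈ D.edges)
    (hc : Crosses e f) (hse : seg e ⊆ seg e₀) (hsf : seg f ⊆ seg f₀) : Crosses e₀ f₀ := by
  obtain ⟨x, hxe, hxf⟩ := hc.2
  have hne : e₀ ≠ f₀ := by
    rintro rfl
    obtain ⟨-, -, h1, h2⟩ := h.same_parent he hf hc.ne h0 hse hsf
    exact hc.1 c h1 h2
  refine D.crosses_of_mem h0 h0' hne (hse hxe) (hsf hxf) (Or.inl fun hx => ?_)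
  have : x ∈ D₁.vertices := by rw [h.vertices_eq]; exact Or.inr ⟨_, h0, hx⟩
  obtain ⟨g, hg, hxg⟩ := this
  exact D₁.notMem_of_crosses he hf hc hxe hxf hg hxg

theorem crossings_eq (h : IsInsertion D D₁ a b c) : D₁.crossings = D.crossings := by
  ext x
  constructor
  · rintro ⟨e, he, f, hf, hc, hxe, hxf⟩
    obtain ⟨e₀, h0, hse⟩ := h.exists_parent he
    obtain ⟨f₀, h0', hsf⟩ := h.exists_parent hf
    exact ⟨e₀, h0, f₀, h0', h.crosses_parent he hf h0 h0' hc hse hsf, hse hxe, hsf hxf⟩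
  · rintro ⟨e₀, h0, f₀, h0', hc, hxe, hxf⟩
    obtain ⟨e, he, hxe, hse, -⟩ := h.exists_child h0 hxe
    obtain ⟨f, hf, hxf, hsf, -⟩ := h.exists_child h0' hxf
    exact ⟨e, he, f, hf, h.crosses_child he h0 h0' hc hse hsf hxe hxf, hxe, hxf⟩

theorem isOver_child (h : IsInsertion D D₁ a b c) {e f e₀ f₀ : Sym2 Plane} (he : e ∈ D₁.edges)
    (hf : f ∈ D₁.edges) (ho : D.isOver e₀ f₀) (hse : seg e ⊆ seg e₀) (hsf : seg f ⊆ seg f₀)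
    {x : Plane} (hxe : x ∈ seg e) (hxf : x ∈ seg f) : D₁.isOver e f := by
  obtain ⟨h0, h0', hc⟩ := D.over_crosses _ _ ho
  exact (h.isOver_iff e f).2 ⟨he, hf, h.crosses_child he h0 h0' hc hse hsf hxe hxf, e₀, f₀, ho,
    hse, hsf⟩

theorem classicalCrossings_eq (h : IsInsertion D D₁ a b c) :
    D₁.classicalCrossings = D.classicalCrossings := by
  ext x
  constructor
  · rintro ⟨e, f, ho, hxe, hxf⟩
    obtain ⟨-, -, -, e₀, f₀, h0, hse, hsf⟩ := (h.isOver_iff e f).1 ho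
    exact ⟨e₀, f₀, h0, hse hxe, hsf hxf⟩
  · rintro ⟨e₀, f₀, ho, hxe, hxf⟩
    obtain ⟨h0, h0', hc⟩ := D.over_crosses _ _ ho
    obtain ⟨e, he, hxe, hse, -⟩ := h.exists_child h0 hxe
    obtain ⟨f, hf, hxf, hsf, -⟩ := h.exists_child h0' hxf
    exact ⟨e, f, h.isOver_child he hf ho hse hsf hxe hxf, hxe, hxf⟩

/-- The constant isotopy works: the curve is the same point set with the same marked points. The
strand condition holds because a crossing is never at `c`. -/
theorem isotopic (h : IsInsertion D D₁ a b c) : Isotopic D D₁ := by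
  refine ⟨fun _ => Homeomorph.refl Plane, continuous_snd, rfl, ?_, ?_, ?_⟩
  · simp [h.support_eq]
  · simp [h.classicalCrossings_eq]
  · rintro e₀ f₀ ho x ⟨hxe, hxf⟩
    obtain ⟨h0, h0', hc⟩ := D.over_crosses _ _ ho
    have hxc : x ≠ c := by
      rintro rfl
      exact hc.ne (h.eq_of_mem h0 h0' hxe hxf)
    obtain ⟨e, he, hxe, hse, hev⟩ := h.exists_child h0 hxe
    obtain ⟨f, hf, hxf, hsf, -⟩ := h.exists_child h0' hxf
    exact ⟨e, f, h.isOver_child he hf ho hse hsf hxe hxf, ⟨hxe, hxf⟩, hev hxc⟩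

theorem equiv (h : IsInsertion D D₁ a b c) : D ≈ D₁ := equiv_of_move (Or.inl h.isotopic)

theorem exists_linked_parent (h : IsInsertion D D₁ a b c) {e f : Sym2 Plane}
    (hl : D₁.Linked e f) : ∃ e₀ f₀, D.Linked e₀ f₀ ∧ seg e ⊆ seg e₀ ∧ seg f ⊆ seg f₀ := by
  rcases hl with hl | hl
  · obtain ⟨-, -, -, e₀, f₀, h0, hse, hsf⟩ := (h.isOver_iff _ _).1 hl
    exact ⟨e₀, f₀, Or.inl h0, hse, hsf⟩
  · obtain ⟨-, -, -, e₀, f₀, h0, hse, hsf⟩ := (h.isOver_iff _ _).1 hl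
    exact ⟨f₀, e₀, Or.inr h0, hsf, hse⟩

theorem linked_child (h : IsInsertion D D₁ a b c) {e f e₀ f₀ : Sym2 Plane} (he : e ∈ D₁.edges)
    (hf : f ∈ D₁.edges) (hl : D.Linked e₀ f₀) (hse : seg e ⊆ seg e₀) (hsf : seg f ⊆ seg f₀)
    {x : Plane} (hxe : x ∈ seg e) (hxf : x ∈ seg f) : D₁.Linked e f := by
  rcases hl with hl | hl
  · exact Or.inl (h.isOver_child he hf hl hse hsf hxe hxf)
  · exact Or.inr (h.isOver_child hf he hl hsf hse hxf hxe)

/-- The edge of `D₁` that contains a classical crossing on an edge of `D` is classical. -/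
theorem isClassical_child (h : IsInsertion D D₁ a b c) {e e₀ f₀ : Sym2 Plane} (he : e ∈ D₁.edges)
    (hl : D.Linked e₀ f₀) (hse : seg e ⊆ seg e₀) {x : Plane} (hxe : x ∈ seg e)
    (hxf : x ∈ seg f₀) : D₁.IsClassical e := by
  obtain ⟨f, hf, hxf, hsf, -⟩ := h.exists_child hl.mem.2.1 hxf
  exact ⟨f, h.linked_child he hf hl hse hsf hxe hxf⟩

/-- An old edge that is not classical does not become classical. -/
theorem isClassical_old (h : IsInsertion D D₁ a b c) {e : Sym2 Plane} (he : e ∈ D.edges)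
    (hc : D₁.IsClassical e) : D.IsClassical e := by
  obtain ⟨f, hl⟩ := hc
  obtain ⟨e₀, f₀, h0, hse, hsf⟩ := h.exists_linked_parent hl
  obtain rfl := h.parent_unique hl.mem.1 h0.mem.1 he hse subset_rfl
  exact ⟨f₀, h0⟩

/-- The crossing on a classical edge is unique and different from `c`, so only one half of a
subdivided classical edge is classical. Different classical edges therefore have different parents,
and all conditions descend from these. -/
theorem separated (h : IsInsertion D D₁ a b c) (hD : D.Separated) : D₁.Separated := by
  -- linked edges of `D` have at most one common point, and it is not `c`
  have hpt : ∀ {e₀ f₀ x y}, D.Linked e₀ f₀ → x ∈ seg e₀ → x ∈ seg f₀ → y ∈ seg e₀ → y ∈ seg f₀ →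
      x = y ∧ x ≠ c := by
    intro e₀ f₀ x y hl h1 h2 h3 h4
    obtain ⟨h0, h0', hc⟩ := hl.mem
    refine ⟨D.edge_generic _ h0 _ h0' hc.ne ⟨h1, h2⟩ ⟨h3, h4⟩, ?_⟩
    rintro rfl
    exact hc.ne (h.eq_of_mem h0 h0' h1 h2)
  have huniq : ∀ {e f g}, D₁.Linked e f → D₁.Linked e g → f = g := by
    intro e f g hf hg
    by_contra hfg
    obtain ⟨e₀, f₀, h0, hse, hsf⟩ := h.exists_linked_parent hf
    obtain ⟨e₁, g₀, h1, hse', hsg⟩ := h.exists_linked_parent hg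
    obtain rfl := h.parent_unique hf.mem.1 h0.mem.1 h1.mem.1 hse hse'
    obtain rfl := hD.linked_unique h0 h1
    obtain ⟨-, h2, -⟩ := h.same_parent hf.mem.2.1 hg.mem.2.1 hfg h0.mem.2.1 hsf hsg
    obtain ⟨x, hxe, hxf⟩ := hf.mem.2.2.2
    obtain ⟨y, hye, hyg⟩ := hg.mem.2.2.2
    obtain ⟨rfl, hxc⟩ := hpt h0 (hse hxe) (hsf hxf) (hse hye) (hsg hyg)
    have : x ∈ seg f ∩ seg g := ⟨hxf, hyg⟩
    rw [h2] at this
    exact hxc this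
  have hparent : ∀ {e f}, D₁.IsClassical e → D₁.IsClassical f → e ≠ f →
      ∃ e₀ f₀, D.IsClassical e₀ ∧ D.IsClassical f₀ ∧ seg e ⊆ seg e₀ ∧ seg f ⊆ seg f₀ ∧
        e₀ ≠ f₀ := by
    rintro e f ⟨e', he⟩ ⟨f', hf⟩ hef
    obtain ⟨e₀, e₀', h0, hse, hse'⟩ := h.exists_linked_parent he
    obtain ⟨f₀, f₀', h1, hsf, hsf'⟩ := h.exists_linked_parent hf
    refine ⟨e₀, f₀, ⟨_, h0⟩, ⟨_, h1⟩, hse, hsf, ?_⟩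
    rintro rfl
    obtain rfl := hD.linked_unique h0 h1
    obtain ⟨-, h2, -⟩ := h.same_parent he.mem.1 hf.mem.1 hef h0.mem.1 hse hsf
    obtain ⟨x, hxe, hxf⟩ := he.mem.2.2.2
    obtain ⟨y, hye, hyg⟩ := hf.mem.2.2.2
    obtain ⟨rfl, hxc⟩ := hpt h0 (hse hxe) (hse' hxf) (hsf hye) (hsf' hyg)
    have : x ∈ seg e ∩ seg f := ⟨hxe, hye⟩
    rw [h2] at this
    exact hxc this
  refine ⟨huniq, ?_, ?_, ?_⟩
  · intro e f he hf hc
    obtain ⟨e₀, f₀, h0, h0', hse, hsf, -⟩ := hparent he hf hc.ne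
    have hc' := h.crosses_parent he.mem hf.mem h0.mem h0'.mem hc hse hsf
    obtain ⟨x, hxe, hxf⟩ := hc.2
    exact h.linked_child he.mem hf.mem (hD.linked_of_crosses h0 h0' hc') hse hsf hxe hxf
  · intro e f he hf hef p hpe hpf
    obtain ⟨e₀, f₀, h0, h0', hse, hsf, hne⟩ := hparent he hf hef
    have h1 := hse (mem_seg_of_mem hpe)
    have h2 := hsf (mem_seg_of_mem hpf)
    have hp : p ∈ D₁.vertices := ⟨e, he.mem, hpe⟩
    rw [h.vertices_eq] at hp
    rcases hp with rfl | ⟨g, hg, hp⟩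
    · exact hne (h.eq_of_mem h0.mem h0'.mem h1 h2)
    · exact hD.notMem h0 h0' hne p (D.vertex_generic _ hg _ h0.mem p hp h1)
        (D.vertex_generic _ hg _ h0'.mem p hp h2)
  · intro u v u' v' he hf hef
    obtain ⟨e₀, f₀, h0, h0', hse, hsf, hne⟩ := hparent he hf hef
    induction e₀ using Sym2.ind with
    | _ a b =>
    induction f₀ using Sym2.ind with
    | _ a' b' =>
    obtain ⟨k, hk, h1⟩ := exists_smul_of_seg_subset (D₁.ne_of_mem he.mem) hse
    obtain ⟨l, hl, h2⟩ := exists_smul_of_seg_subset (D₁.ne_of_mem hf.mem) hsf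
    rw [h1, h2, cross_smul_smul]
    exact mul_ne_zero (mul_ne_zero hk hl) (hD.cross_ne h0 h0' hne)

end IsInsertion

end Diagram
end VirtualKnot

/-! ### Repeated subdivision, and images of diagrams under maps. -/

namespace VirtualKnot

theorem closedEdges_rotate (L : List Plane) (k : ℕ) : closedEdges (L.rotate k) = closedEdges L := by
  rw [List.rotate_eq_drop_append_take_mod, closedEdges_append_comm, List.take_append_drop]

theorem vertexAt_rotate (L : List Plane) (h : L ≠ []) (k i : ℕ) :
    vertexAt (L.rotate k) i = vertexAt L (i + k) := by
  have hpos := List.length_pos_of_ne_nil h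
  have h1 : i % L.length < (L.rotate k).length := by
    rw [List.length_rotate]; exact Nat.mod_lt _ hpos
  rw [← vertexAt_mod (L.rotate k), List.length_rotate, vertexAt_of_lt h1, List.getElem_rotate,
    ← vertexAt_of_lt (Nat.mod_lt _ hpos), vertexAt_mod, ← vertexAt_mod L (_ + k), Nat.mod_add_mod,
    vertexAt_mod]

theorem edgeAt_rotate (L : List Plane) (h : L ≠ []) (k i : ℕ) :
    edgeAt (L.rotate k) i = edgeAt L (i + k) := by
  rw [edgeAt, edgeAt, vertexAt_rotate L h, vertexAt_rotate L h, add_right_comm]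

theorem pathEdges_map (φ : Plane → Plane) (l : List Plane) :
    pathEdges (l.map φ) = Sym2.map φ '' pathEdges l := by
  induction l with
  | nil => simp [pathEdges]
  | cons a l ih =>
    cases l with
    | nil => simp [pathEdges]
    | cons b l =>
      simp only [List.map_cons, pathEdges] at ih ⊢
      rw [ih, Set.image_insert_eq, Sym2.map_mk]

/-- A map that is affine on a segment maps the segment to a segment. -/
theorem image_seg {φ : Plane → Plane} {a b : Plane}
    (h : ∀ t ∈ Set.Icc (0 : ℝ) 1, φ (AffineMap.lineMap a b t) = AffineMap.lineMap (φ a) (φ b) t) :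
    φ '' seg s(a, b) = seg s(φ a, φ b) := by
  ext x
  constructor
  · rintro ⟨y, hy, rfl⟩
    obtain ⟨t, ht, rfl⟩ := mem_seg_iff.1 hy
    exact mem_seg_iff.2 ⟨t, ht, (h t ht).symm⟩
  · intro hx
    obtain ⟨t, ht, rfl⟩ := mem_seg_iff.1 hx
    exact ⟨_, mem_seg_iff.2 ⟨t, ht, rfl⟩, h t ht⟩

namespace Diagram

theorem exists_list_of_mem (D : Diagram) {e : Sym2 Plane} (he : e ∈ D.edges) :
    ∃ (a b : Plane) (R : List Plane), (a :: b :: R).Nodup ∧ R ≠ [] ∧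
      D.edges = closedEdges (a :: b :: R) ∧ e = s(a, b) := by
  obtain ⟨L, h1, h2, h3⟩ := D.exists_list
  have hL : L ≠ [] := by rintro rfl; simp at h2
  rw [h3] at he
  obtain ⟨i, hi, rfl⟩ := mem_closedEdges.1 he
  have h4 := edgeAt_rotate L hL i 0
  rw [zero_add] at h4
  have h5 : (L.rotate i).length = L.length := List.length_rotate ..
  have h6 : (L.rotate i).Nodup := List.nodup_rotate.2 h1
  have h7 := closedEdges_rotate L i
  rw [← h4]
  generalize L.rotate i = M at *
  match M, h5 with
  | [], h5 => simp at h5; omega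
  | [a], h5 => simp at h5; omega
  | a :: b :: R, h5 =>
    refine ⟨a, b, R, h6, ?_, h3.trans h7.symm, edgeAt_zero a b R⟩
    rintro rfl
    simp at h5; omega

/-- The vertex list may traverse the edge from `b` to `a`, so the end points of the insertion are
only known as an unordered pair. -/
theorem exists_isInsertion_of_mem (D : Diagram) {a b c : Plane} (he : s(a, b) ∈ D.edges)
    (hc : c ∈ openSegment ℝ a b) (hg : ∀ g ∈ D.edges, g ≠ s(a, b) → c ∉ seg g) :
    ∃ D₁ a' b', IsInsertion D D₁ a' b' c := by
  obtain ⟨a', b', R, h1, h2, h3, h4⟩ := D.exists_list_of_mem he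
  have hc' : c ∈ openSegment ℝ a' b' := by
    rcases Sym2.eq_iff.1 h4 with ⟨rfl, rfl⟩ | ⟨rfl, rfl⟩
    · exact hc
    · rw [openSegment_symm]; exact hc
  obtain ⟨D₁, h5, -⟩ := D.exists_isInsertion h1 h2 h3 hc' (h4 ▸ hg)
  exact ⟨D₁, a', b', h5⟩

/-- `D₁` arises from `D` by subdividing edges. -/
structure Subdivides (D D₁ : Diagram) : Prop where
  equiv : D ≈ D₁
  support_eq : D₁.support = D.support
  crossings_eq : D₁.crossings = D.crossings
  classicalCrossings_eq : D₁.classicalCrossings = D.classicalCrossings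
  exists_parent : ∀ e ∈ D₁.edges, ∃ e₀ ∈ D.edges, seg e ⊆ seg e₀

/-- Points are inserted one at a time, and those that are vertices already are skipped. A remaining
point that is no crossing lies on just one edge, as an insertion requires. -/
theorem exists_subdivides (D : Diagram) (T : Finset Plane) (hT : ↑T ⊆ D.support)
    (hT' : ∀ x ∈ T, x ∉ D.crossings) : ∃ D₁, Subdivides D D₁ ∧ ↑T ⊆ D₁.vertices := by
  induction T using Finset.induction_on with
  | empty => exact ⟨D, ⟨Setoid.refl D, rfl, rfl, rfl, fun e he => ⟨e, he, subset_rfl⟩⟩, by simp⟩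
  | insert c T hcT ih =>
    rw [Finset.coe_insert, Set.insert_subset_iff] at hT
    obtain ⟨D₁, h1, h2⟩ := ih hT.2 fun x hx => hT' x (Finset.mem_insert_of_mem hx)
    by_cases hcv : c ∈ D₁.vertices
    · exact ⟨D₁, h1, by rw [Finset.coe_insert, Set.insert_subset_iff]; exact ⟨hcv, h2⟩⟩
    have hcs := hT.1
    rw [← h1.support_eq] at hcs
    simp only [support, Set.mem_iUnion, exists_prop] at hcs
    obtain ⟨e, he, hce⟩ := hcs
    have hcr := hT' c (Finset.mem_insert_self _ _)
    rw [← h1.crossings_eq] at hcr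
    have hg : ∀ g ∈ D₁.edges, g ≠ e → c ∉ seg g := fun g hg hge hcg =>
      hcr ⟨g, hg, e, he, D₁.crosses_of_mem hg he hge hcg hce (Or.inl fun h => hcv ⟨g, hg, h⟩),
        hcg, hce⟩
    induction e using Sym2.ind with
    | _ a b =>
    have hc : c ∈ openSegment ℝ a b := by
      rw [seg_mk] at hce
      refine mem_openSegment_of_ne_left_right ?_ ?_ hce
      · rintro rfl; exact hcv ⟨_, he, by simp⟩
      · rintro rfl; exact hcv ⟨_, he, by simp⟩
    obtain ⟨D₂, a', b', h3⟩ := D₁.exists_isInsertion_of_mem he hc hg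
    refine ⟨D₂, ⟨Setoid.trans h1.equiv h3.equiv, h3.support_eq.trans h1.support_eq,
      h3.crossings_eq.trans h1.crossings_eq,
      h3.classicalCrossings_eq.trans h1.classicalCrossings_eq, fun e he => ?_⟩, ?_⟩
    · obtain ⟨e₁, h4, h5⟩ := h3.exists_parent he
      obtain ⟨e₀, h6, h7⟩ := h1.exists_parent e₁ h4
      exact ⟨e₀, h6, h5.trans h7⟩
    · rw [h3.vertices_eq, Finset.coe_insert]
      exact Set.insert_subset_insert h2

section Map

variable (D : Diagram) {φ : Plane → Plane}

theorem crosses_map_iff (hφ : Function.Injective φ)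
    (hs : ∀ e ∈ D.edges, φ '' seg e = seg (e.map φ)) {e f : Sym2 Plane} (he : e ∈ D.edges)
    (hf : f ∈ D.edges) : Crosses (e.map φ) (f.map φ) ↔ Crosses e f := by
  rw [Crosses, Crosses, ← hs e he, ← hs f hf, ← Set.image_inter hφ, Set.image_nonempty]
  refine and_congr_left fun _ => ?_
  constructor
  · intro h p hp hq
    exact h (φ p) (Sym2.mem_map.2 ⟨p, hp, rfl⟩) (Sym2.mem_map.2 ⟨p, hq, rfl⟩)
  · intro h p hp hq
    obtain ⟨q, hq1, rfl⟩ := Sym2.mem_map.1 hp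
    obtain ⟨q', hq2, h3⟩ := Sym2.mem_map.1 hq
    rw [hφ h3] at hq2
    exact h q hq1 hq2

/-- The image of a diagram under an injective map that maps each edge to a segment. -/
def map (hφ : Function.Injective φ) (hs : ∀ e ∈ D.edges, φ '' seg e = seg (e.map φ)) :
    Diagram where
  edges := Sym2.map φ '' D.edges
  isOver e' f' := ∃ e f, D.isOver e f ∧ e.map φ = e' ∧ f.map φ = f'
  closed_polygon := by
    obtain ⟨v, l, h1, h2, h3⟩ := D.closed_polygon
    refine ⟨φ v, l.map φ, ?_, by simpa using h2, ?_⟩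
    · rw [← List.map_cons]
      exact h1.map hφ
    · rw [h3, ← pathEdges_map]
      simp
  vertex_generic := by
    rintro _ ⟨e, he, rfl⟩ _ ⟨f, hf, rfl⟩ p hp hpf
    obtain ⟨q, hq, rfl⟩ := Sym2.mem_map.1 hp
    rw [← hs f hf] at hpf
    exact Sym2.mem_map.2 ⟨q, D.vertex_generic e he f hf q hq
      ((Function.Injective.mem_set_image hφ).1 hpf), rfl⟩
  edge_generic := by
    rintro _ ⟨e, he, rfl⟩ _ ⟨f, hf, rfl⟩ hef
    rw [← hs e he, ← hs f hf, ← Set.image_inter hφ]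
    exact (D.edge_generic e he f hf fun h => hef (h ▸ rfl)).image φ
  no_triple := by
    rintro _ ⟨e, he, rfl⟩ _ ⟨f, hf, rfl⟩ _ ⟨g, hg, rfl⟩ h1 h2 h3
    rw [← hs e he, ← hs f hf, ← hs g hg, ← Set.image_inter hφ, ← Set.image_inter hφ,
      D.no_triple e he f hf g hg (fun h => h1 (h ▸ rfl)) (fun h => h2 (h ▸ rfl))
      (fun h => h3 (h ▸ rfl)), Set.image_empty]
  over_crosses := by
    rintro _ _ ⟨e, f, h, rfl, rfl⟩
    obtain ⟨he, hf, hc⟩ := D.over_crosses e f h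
    exact ⟨⟨e, he, rfl⟩, ⟨f, hf, rfl⟩, (D.crosses_map_iff hφ hs he hf).2 hc⟩
  over_asymm := by
    rintro _ _ ⟨e, f, h, rfl, rfl⟩ ⟨f', e', h', h1, h2⟩
    rw [Sym2.map.injective hφ h1, Sym2.map.injective hφ h2] at h'
    exact D.over_asymm _ _ h h'

variable (hφ : Function.Injective φ) (hs : ∀ e ∈ D.edges, φ '' seg e = seg (e.map φ))

theorem support_map : (D.map hφ hs).support = φ '' D.support := by
  have h1 : (D.map hφ hs).edges = Sym2.map φ '' D.edges := rfl
  rw [support, h1, Set.biUnion_image, support, Set.image_iUnion₂]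
  exact Set.iUnion₂_congr fun e he => (hs e he).symm

theorem classicalCrossings_map :
    (D.map hφ hs).classicalCrossings = φ '' D.classicalCrossings := by
  ext x
  constructor
  · rintro ⟨_, _, ⟨e, f, h, rfl, rfl⟩, hx⟩
    obtain ⟨he, hf, -⟩ := D.over_crosses e f h
    rw [← hs e he, ← hs f hf, ← Set.image_inter hφ] at hx
    obtain ⟨y, hy, rfl⟩ := hx
    exact ⟨y, ⟨e, f, h, hy⟩, rfl⟩
  · rintro ⟨y, ⟨e, f, h, hy⟩, rfl⟩
    obtain ⟨he, hf, -⟩ := D.over_crosses e f h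
    refine ⟨_, _, ⟨e, f, h, rfl, rfl⟩, ?_⟩
    rw [← hs e he, ← hs f hf]
    exact ⟨⟨y, hy.1, rfl⟩, ⟨y, hy.2, rfl⟩⟩

theorem numClassical_map : (D.map hφ hs).numClassical = D.numClassical := by
  rw [numClassical, classicalCrossings_map, Set.ncard_image_of_injective _ hφ, numClassical]

theorem isotopic_map (H : I → (Plane ≃ₜ Plane))
    (hc : Continuous (fun q : I × Plane => H q.1 q.2)) (h0 : H 0 = Homeomorph.refl Plane)
    (h1 : ⇑(H 1) = φ) : Isotopic D (D.map hφ hs) := by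
  refine ⟨H, hc, h0, ?_, ?_, ?_⟩
  · rw [h1, support_map]
  · rw [h1, classicalCrossings_map]
  · rintro e f h x ⟨hxe, hxf⟩
    obtain ⟨he, hf, -⟩ := D.over_crosses e f h
    refine ⟨_, _, ⟨e, f, h, rfl, rfl⟩, ?_, ?_⟩
    · rw [h1, ← hs e he, ← hs f hf]
      exact ⟨⟨x, hxe, rfl⟩, ⟨x, hxf, rfl⟩⟩
    · rw [h1, ← hs e he]
      exact Filter.Eventually.of_forall fun y hy => ⟨y, hy, rfl⟩

theorem linked_map_iff {e f : Sym2 Plane} :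
    (D.map hφ hs).Linked (e.map φ) (f.map φ) ↔ D.Linked e f := by
  have key : ∀ {e f : Sym2 Plane}, (D.map hφ hs).isOver (e.map φ) (f.map φ) ↔ D.isOver e f := by
    intro e f
    constructor
    · rintro ⟨e', f', h, h1, h2⟩
      rwa [Sym2.map.injective hφ h1, Sym2.map.injective hφ h2] at h
    · exact fun h => ⟨e, f, h, rfl, rfl⟩
  rw [Linked, Linked, key, key]

theorem isClassical_map_iff {e : Sym2 Plane} :
    (D.map hφ hs).IsClassical (e.map φ) ↔ D.IsClassical e := by
  constructor
  · rintro ⟨_, hf⟩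
    obtain ⟨f, -, rfl⟩ := hf.mem.2.1
    exact ⟨f, (D.linked_map_iff hφ hs).1 hf⟩
  · rintro ⟨f, hf⟩
    exact ⟨f.map φ, (D.linked_map_iff hφ hs).2 hf⟩

/-- Incidences are preserved by an injective map that sends edges to segments; directions are not.
Hence the first three conditions are asked of `D`, and the last one of the images. -/
theorem separated_map
    (h1 : ∀ {e f g}, D.Linked e f → D.Linked e g → f = g)
    (h2 : ∀ {e f}, D.IsClassical e → D.IsClassical f → Crosses e f → D.Linked e f)
    (h3 : ∀ {e f}, D.IsClassical e → D.IsClassical f → e ≠ f → ∀ p ∈ e, p ∉ f)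
    (h4 : ∀ {a b c d}, D.IsClassical s(a, b) → D.IsClassical s(c, d) → s(a, b) ≠ s(c, d) →
      cross (φ b - φ a) (φ d - φ c) ≠ 0) : (D.map hφ hs).Separated := by
  refine ⟨?_, ?_, ?_, ?_⟩
  · rintro e f g hf hg
    obtain ⟨e, -, rfl⟩ := hf.mem.1
    obtain ⟨f, -, rfl⟩ := hf.mem.2.1
    obtain ⟨g, -, rfl⟩ := hg.mem.2.1
    rw [h1 ((D.linked_map_iff hφ hs).1 hf) ((D.linked_map_iff hφ hs).1 hg)]
  · rintro e f he hf hc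
    obtain ⟨e, he', rfl⟩ := he.mem
    obtain ⟨f, hf', rfl⟩ := hf.mem
    rw [linked_map_iff]
    rw [isClassical_map_iff] at he hf
    exact h2 he hf ((D.crosses_map_iff hφ hs he' hf').1 hc)
  · rintro e f he hf hne p hp hp'
    obtain ⟨e, he', rfl⟩ := he.mem
    obtain ⟨f, hf', rfl⟩ := hf.mem
    rw [isClassical_map_iff] at he hf
    obtain ⟨q, hq, rfl⟩ := Sym2.mem_map.1 hp
    obtain ⟨q', hq', h⟩ := Sym2.mem_map.1 hp'
    rw [hφ h] at hq'
    exact h3 he hf (fun h => hne (h ▸ rfl)) q hq hq'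
  · intro a b c d he hf hne
    obtain ⟨e, he', hae⟩ := he.mem
    obtain ⟨f, hf', haf⟩ := hf.mem
    rw [← hae, isClassical_map_iff] at he
    rw [← haf, isClassical_map_iff] at hf
    rw [← hae, ← haf] at hne
    have hne' : e ≠ f := fun h => hne (h ▸ rfl)
    have h5 : ∀ {u v : Plane} {e : Sym2 Plane}, e.map φ = s(u, v) →
        ∃ u' v', e = s(u', v') ∧ φ u' = u ∧ φ v' = v := by
      intro u v e h
      induction e using Sym2.ind with
      | _ u' v' =>
      rw [Sym2.map_mk] at h
      rcases Sym2.eq_iff.1 h with ⟨h, h'⟩ | ⟨h, h'⟩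
      · exact ⟨u', v', rfl, h, h'⟩
      · exact ⟨v', u', Sym2.eq_swap, h', h⟩
    obtain ⟨a, b, rfl, rfl, rfl⟩ := h5 hae
    obtain ⟨c, d, rfl, rfl, rfl⟩ := h5 haf
    exact h4 he hf hne'

end Map

end Diagram
end VirtualKnot

/-! ### Piecewise linear shears, and making a diagram separated. -/

namespace VirtualKnot

/-- A linear functional on the plane. -/
def height (r : ℝ) (p : Plane) : ℝ := p.1 + r * p.2

theorem height_lineMap (r : ℝ) (a b : Plane) (t : ℝ) :
    height r (AffineMap.lineMap a b t) = (1 - t) * height r a + t * height r b := by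
  simp only [height, AffineMap.lineMap_apply, vsub_eq_sub, vadd_eq_add, Prod.fst_sub,
    Prod.snd_sub, Prod.fst_add, Prod.snd_add, Prod.smul_fst, Prod.smul_snd, smul_eq_mul]
  ring

/-- Two different points have the same height for at most one slope `r`, so only finitely many
slopes are bad. -/
theorem exists_height_injOn {P : Set Plane} (hP : P.Finite) : ∃ r, Set.InjOn (height r) P := by
  have hfin : (⋃ z ∈ P, ⋃ w ∈ P, {r : ℝ | z ≠ w ∧ height r z = height r w}).Finite := by
    refine hP.biUnion fun z _ => hP.biUnion fun w _ => Set.Subsingleton.finite ?_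
    rintro r ⟨hzw, hr⟩ s ⟨-, hs⟩
    simp only [height] at hr hs
    have h1 : (r - s) * (z.2 - w.2) = 0 := by linear_combination hr - hs
    rcases mul_eq_zero.1 h1 with h2 | h2
    · linarith
    · have h3 : z.2 = w.2 := by linarith
      exact absurd (Prod.ext (by rw [h3] at hr; linarith) h3) hzw
  obtain ⟨r, hr⟩ := hfin.infinite_compl.nonempty
  refine ⟨r, fun z hz w hw h => by_contra fun hzw => hr ?_⟩
  simp only [Set.mem_iUnion]
  exact ⟨z, hz, w, hw, hzw, h⟩

/-- The factor 2 makes the strips of half-width `δ` around different points disjoint. -/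
theorem exists_gap {P : Set Plane} (hP : P.Finite) {r : ℝ} (hr : Set.InjOn (height r) P) :
    ∃ δ > 0, ∀ z ∈ P, ∀ w ∈ P, z ≠ w → 2 * δ < |height r z - height r w| := by
  have h : ∀ᶠ δ in 𝓝[>] (0 : ℝ), ∀ z ∈ P, ∀ w ∈ P, z ≠ w → 2 * δ < |height r z - height r w| := by
    refine (Filter.eventually_all_finite hP).2 fun z hz =>
      (Filter.eventually_all_finite hP).2 fun w hw => ?_
    by_cases hzw : z = w
    · simp [hzw]
    have h0 : 0 < |height r z - height r w| :=
      abs_pos.2 (sub_ne_zero.2 fun h => hzw (hr hz hw h))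
    have h1 : ∀ᶠ δ in 𝓝 (0 : ℝ), δ < |height r z - height r w| / 2 :=
      eventually_lt_nhds (by linarith)
    filter_upwards [nhdsWithin_le_nhds h1] with δ hδ _
    linarith
  obtain ⟨δ, h1, h2⟩ := (h.and self_mem_nhdsWithin).exists
  exact ⟨δ, h2, h1⟩

/-- A convex piecewise linear function with break points `B`. -/
def ramp (B : Finset ℝ) (x : ℝ) : ℝ := ∑ β ∈ B, max 0 (x - β)

theorem continuous_ramp (B : Finset ℝ) : Continuous (ramp B) := by
  unfold ramp
  fun_prop

/-- Away from break points the slope of `ramp B` is the number of break points to the left. The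
point `z` only serves to fix the linear piece in which `x` and `y` lie. -/
theorem ramp_sub {B : Finset ℝ} {x y z : ℝ}
    (h : ∀ β ∈ B, (β < z ∧ β ≤ x ∧ β ≤ y) ∨ (z ≤ β ∧ x ≤ β ∧ y ≤ β)) :
    ramp B y - ramp B x = (B.filter (· < z)).card * (y - x) := by
  rw [ramp, ramp, ← Finset.sum_sub_distrib, ← nsmul_eq_mul, ← Finset.sum_const, Finset.sum_filter]
  refine Finset.sum_congr rfl fun β hβ => ?_
  rcases h β hβ with ⟨h1, h2, h3⟩ | ⟨h1, h2, h3⟩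
  · rw [if_pos h1, max_eq_right (by linarith), max_eq_right (by linarith)]; ring
  · rw [if_neg (not_lt.2 h1), max_eq_left (by linarith), max_eq_left (by linarith)]; ring

theorem ramp_affine {B : Finset ℝ} {x y : ℝ}
    (h : ∀ β ∈ B, (β ≤ x ∧ β ≤ y) ∨ (x ≤ β ∧ y ≤ β)) {t : ℝ} (ht : t ∈ Set.Icc (0 : ℝ) 1) :
    ramp B ((1 - t) * x + t * y) = (1 - t) * ramp B x + t * ramp B y := by
  simp only [ramp, Finset.mul_sum, ← Finset.sum_add_distrib]
  refine Finset.sum_congr rfl fun β hβ => ?_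
  obtain ⟨ht0, ht1⟩ := ht
  have ht1' : 0 ≤ 1 - t := by linarith
  rcases h β hβ with ⟨h2, h3⟩ | ⟨h2, h3⟩
  · have h4 := mul_le_mul_of_nonneg_left h2 ht1'
    have h5 := mul_le_mul_of_nonneg_left h3 ht0
    rw [max_eq_right (by linarith), max_eq_right (by linarith), max_eq_right (by linarith)]; ring
  · have h4 := mul_le_mul_of_nonneg_left h2 ht1'
    have h5 := mul_le_mul_of_nonneg_left h3 ht0
    rw [max_eq_left (by linarith), max_eq_left (by linarith), max_eq_left (by linarith)]; ring

/-- A piecewise linear shear along the level lines of `height r`. -/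
noncomputable def shear (r : ℝ) (B : Finset ℝ) (s : ℝ) (p : Plane) : Plane :=
  p + (s * ramp B (height r p)) • ((-r, 1) : Plane)

theorem height_shear (r : ℝ) (B : Finset ℝ) (s : ℝ) (p : Plane) :
    height r (shear r B s p) = height r p := by
  simp only [height, shear, Prod.fst_add, Prod.snd_add, Prod.smul_mk, smul_eq_mul]
  ring

theorem shear_shear (r : ℝ) (B : Finset ℝ) (s t : ℝ) (p : Plane) :
    shear r B s (shear r B t p) = shear r B (s + t) p := by
  rw [shear, height_shear, shear, shear]
  module

theorem shear_zero (r : ℝ) (B : Finset ℝ) (p : Plane) : shear r B 0 p = p := by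
  simp [shear]

theorem continuous_shear (r : ℝ) (B : Finset ℝ) :
    Continuous (fun q : ℝ × Plane => shear r B q.1 q.2) := by
  have h := continuous_ramp B
  unfold shear height
  fun_prop

/-- The shear as a homeomorphism. -/
noncomputable def shearHomeo (r : ℝ) (B : Finset ℝ) (s : ℝ) : Plane ≃ₜ Plane where
  toFun := shear r B s
  invFun := shear r B (-s)
  left_inv p := by rw [shear_shear, neg_add_cancel, shear_zero]
  right_inv p := by rw [shear_shear, add_neg_cancel, shear_zero]
  continuous_toFun := (continuous_shear r B).comp (by fun_prop : Continuous fun p : Plane => (s, p))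
  continuous_invFun :=
    (continuous_shear r B).comp (by fun_prop : Continuous fun p : Plane => (-s, p))

theorem shear_lineMap {r : ℝ} {B : Finset ℝ} {a b : Plane}
    (h : ∀ β ∈ B, (β ≤ height r a ∧ β ≤ height r b) ∨ (height r a ≤ β ∧ height r b ≤ β)) (s : ℝ)
    {t : ℝ} (ht : t ∈ Set.Icc (0 : ℝ) 1) :
    shear r B s (AffineMap.lineMap a b t) =
      AffineMap.lineMap (shear r B s a) (shear r B s b) t := by
  rw [shear, height_lineMap, ramp_affine h ht]
  simp only [AffineMap.lineMap_apply, vsub_eq_sub, vadd_eq_add, shear]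
  module

/-- The effect of a shear on the determinant of the directions of two edges. -/
theorem cross_shear {r : ℝ} {B : Finset ℝ} {a b c d : Plane} {k l : ℝ}
    (h1 : ramp B (height r b) - ramp B (height r a) = k * (height r b - height r a))
    (h2 : ramp B (height r d) - ramp B (height r c) = l * (height r d - height r c)) (s : ℝ) :
    cross (shear r B s b - shear r B s a) (shear r B s d - shear r B s c) =
      cross (b - a) (d - c) +
        s * ((l - k) * (height r b - height r a) * (height r d - height r c)) := by
  -- Both directions change by multiples of the same vector `(-r, 1)`, so there is no term in `s ^
  -- 2`. The determinant of a vector with `(-r, 1)` is its height, which gives the linear term.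
  have h3 : shear r B s b - shear r B s a =
      (b - a) + (s * (k * (height r b - height r a))) • ((-r, 1) : Plane) := by
    rw [← h1, shear, shear]; module
  have h4 : shear r B s d - shear r B s c =
      (d - c) + (s * (l * (height r d - height r c))) • ((-r, 1) : Plane) := by
    rw [← h2, shear, shear]; module
  rw [h3, h4]
  simp only [cross, height, Prod.fst_add, Prod.snd_add, Prod.smul_mk, smul_eq_mul, Prod.fst_sub,
    Prod.snd_sub]
  ring

namespace Diagram

theorem crossings_finite' (D : Diagram) : D.crossings.Finite := D.crossings_finite

theorem mem_crossings_of_linked {D : Diagram} {e f : Sym2 Plane} (h : D.Linked e f) {x : Plane}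
    (hxe : x ∈ seg e) (hxf : x ∈ seg f) : x ∈ D.crossings :=
  ⟨e, h.mem.1, f, h.mem.2.1, h.mem.2.2, hxe, hxf⟩

theorem notMem_of_mem_crossings {D : Diagram} {x : Plane} (h : x ∈ D.crossings) {g : Sym2 Plane}
    (hg : g ∈ D.edges) : x ∉ g := by
  obtain ⟨e, he, f, hf, hc, hxe, hxf⟩ := h
  exact D.notMem_of_crosses he hf hc hxe hxf hg

/-- Every diagram can be subdivided such that the edges of the new diagram lie in strips with
at most one crossing each, and crossings in different strips are separated by a gap. -/
theorem exists_strips (D : Diagram) : ∃ (D₁ : Diagram) (r : ℝ) (B : Finset ℝ) (δ : ℝ),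
    Subdivides D D₁ ∧ 0 < δ ∧
    (∀ z ∈ D₁.crossings, ∀ w ∈ D₁.crossings, z ≠ w → 2 * δ < |height r z - height r w|) ∧
    (∀ z ∈ D₁.crossings, height r z - δ ∈ B ∧ height r z + δ ∈ B ∧ height r z ∉ B) ∧
    (∀ a b, s(a, b) ∈ D₁.edges → height r a ≠ height r b) ∧
    (∀ a b, s(a, b) ∈ D₁.edges → ∀ β ∈ B,
      (β ≤ height r a ∧ β ≤ height r b) ∨ (height r a ≤ β ∧ height r b ≤ β)) := by
  have hP : (D.vertices ∪ D.crossings).Finite := D.vertices_finite.union D.crossings_finite'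
  obtain ⟨r, hr⟩ := exists_height_injOn hP
  obtain ⟨δ, hδ, hgap⟩ := exists_gap hP hr
  have hBfin : ((fun z => height r z - δ) '' D.crossings ∪
      (fun z => height r z + δ) '' D.crossings).Finite :=
    (D.crossings_finite'.image _).union (D.crossings_finite'.image _)
  set B : Finset ℝ := hBfin.toFinset with hB
  -- A break point lies at distance exactly `δ` from the height of a crossing, while the heights of
  -- different special points are more than `2 * δ` apart.
  have hBP : ∀ z ∈ D.vertices ∪ D.crossings, height r z ∉ B := by
    intro z hz hzB
    rw [hB, Set.Finite.mem_toFinset] at hzB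
    have key : ∀ w ∈ D.crossings, |height r w - height r z| = δ → False := by
      intro w hw h
      by_cases hwz : w = z
      · subst hwz
        rw [sub_self, abs_zero] at h
        linarith
      · have := hgap w (Or.inr hw) z hz hwz
        linarith
    rcases hzB with ⟨w, hw, h⟩ | ⟨w, hw, h⟩
    · refine key w hw ?_
      rw [← h]
      simp [abs_of_pos hδ]
    · refine key w hw ?_
      rw [← h]
      simp [abs_of_pos hδ]
  -- the height is injective on each edge
  have hinj : ∀ e ∈ D.edges, Set.InjOn (height r) (seg e) := by
    intro e he
    induction e using Sym2.ind with
    | _ a b =>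
    have hab : height r a ≠ height r b := fun h =>
      D.ne_of_mem he (hr (Or.inl ⟨_, he, by simp⟩) (Or.inl ⟨_, he, by simp⟩) h)
    rintro x hx y hy hxy
    obtain ⟨t, -, rfl⟩ := mem_seg_iff.1 hx
    obtain ⟨s, -, rfl⟩ := mem_seg_iff.1 hy
    rw [height_lineMap, height_lineMap] at hxy
    have h1 : (t - s) * (height r b - height r a) = 0 := by linear_combination hxy
    rcases mul_eq_zero.1 h1 with h1 | h1
    · rw [sub_eq_zero.1 h1]
    · exact absurd (sub_eq_zero.1 h1).symm hab
  -- These are the points at which the curve changes strip; they become the new vertices.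
  have hTfin : {x | x ∈ D.support ∧ height r x ∈ B}.Finite := by
    have : (⋃ e ∈ D.edges, ⋃ β ∈ B, {x | x ∈ seg e ∧ height r x = β}).Finite := by
      refine D.edges_finite.biUnion fun e he => B.finite_toSet.biUnion fun β _ =>
        Set.Subsingleton.finite ?_
      rintro x ⟨hx, hxβ⟩ y ⟨hy, hyβ⟩
      exact hinj e he hx hy (hxβ.trans hyβ.symm)
    refine this.subset ?_
    rintro x ⟨hx, hxB⟩
    simp only [support, Set.mem_iUnion, exists_prop] at hx ⊢
    obtain ⟨e, he, hx⟩ := hx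
    exact ⟨e, he, _, hxB, hx, rfl⟩
  obtain ⟨D₁, h1, h2⟩ := D.exists_subdivides hTfin.toFinset
    (by intro x hx; simp at hx; exact hx.1)
    (by
      intro x hx hxc
      rw [Set.Finite.mem_toFinset] at hx
      exact hBP x (Or.inr hxc) hx.2)
  have hne : ∀ a b, s(a, b) ∈ D₁.edges → height r a ≠ height r b := by
    intro a b hab h
    obtain ⟨e₀, h0, hs⟩ := h1.exists_parent _ hab
    exact D₁.ne_of_mem hab (hinj e₀ h0 (hs (mem_seg_of_mem (by simp)))
      (hs (mem_seg_of_mem (by simp))) h)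
  refine ⟨D₁, r, B, δ, h1, hδ, ?_, ?_, hne, ?_⟩
  · rw [h1.crossings_eq]
    exact fun z hz w hw => hgap z (Or.inr hz) w (Or.inr hw)
  · rw [h1.crossings_eq]
    intro z hz
    refine ⟨?_, ?_, hBP z (Or.inr hz)⟩
    · rw [hB, Set.Finite.mem_toFinset]
      exact Or.inl ⟨z, hz, rfl⟩
    · rw [hB, Set.Finite.mem_toFinset]
      exact Or.inr ⟨z, hz, rfl⟩
  · intro a b hab β hβ
    -- A break height strictly between the heights of the ends is attained inside the edge, at a
    -- point that was made a vertex. This contradicts `vertex_generic`.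
    by_contra hcon
    have hba := sub_ne_zero.2 (hne a b hab).symm
    set t := (β - height r a) / (height r b - height r a) with ht
    have ht' : t * (height r b - height r a) = β - height r a := div_mul_cancel₀ _ hba
    have h3 : 0 < t ∧ t < 1 := by
      rcases lt_or_gt_of_ne hba with h | h
      · have h4 : height r b < β ∧ β < height r a := by
          constructor <;> by_contra h5 <;> apply hcon
          · left; constructor <;> linarith
          · right; constructor <;> linarith
        exact ⟨div_pos_of_neg_of_neg (by linarith) h, (div_lt_one_of_neg h).2 (by linarith)⟩
      · have h4 : height r a < β ∧ β < height r b := by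
          constructor <;> by_contra h5 <;> apply hcon
          · left; constructor <;> linarith
          · right; constructor <;> linarith
        exact ⟨div_pos (by linarith) h, (div_lt_one h).2 (by linarith)⟩
    have hx : AffineMap.lineMap a b t ∈ seg s(a, b) := mem_seg_iff.2 ⟨t, ⟨h3.1.le, h3.2.le⟩, rfl⟩
    have hxh : height r (AffineMap.lineMap a b t) = β := by
      rw [height_lineMap]; linear_combination ht'
    obtain ⟨g, hg, hxg⟩ : AffineMap.lineMap a b t ∈ D₁.vertices := by
      refine h2 ?_
      rw [Finset.mem_coe, Set.Finite.mem_toFinset]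
      refine ⟨?_, by rw [hxh]; exact hβ⟩
      rw [← h1.support_eq]
      simp only [support, Set.mem_iUnion, exists_prop]
      exact ⟨_, hab, hx⟩
    have hinj := lineMap_injective' (D₁.ne_of_mem hab)
    rcases Sym2.mem_iff.1 (D₁.vertex_generic g hg _ hab _ hxg hx) with h4 | h4
    · have : t = 0 := hinj (h4.trans (AffineMap.lineMap_apply_zero a b).symm)
      linarith
    · have : t = 1 := hinj (h4.trans (AffineMap.lineMap_apply_one a b).symm)
      linarith

/-- Every diagram is equivalent to a separated one with the same number of classical crossings. -/
theorem exists_separated (D : Diagram) :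
    ∃ D' : Diagram, D ≈ D' ∧ D'.numClassical = D.numClassical ∧ D'.Separated := by
  obtain ⟨D₁, r, B, δ, hsub, hδ, hgap, hB, hne, hstrip⟩ := D.exists_strips
  -- An edge through the crossing `z` cannot pass the break heights `height r z ± δ`, so it stays in
  -- the strip around `z` and contains no other crossing.
  have hnear : ∀ {a b z}, s(a, b) ∈ D₁.edges → z ∈ D₁.crossings → z ∈ seg s(a, b) →
      |height r a - height r z| ≤ δ ∧ |height r b - height r z| ≤ δ := by
    intro a b z hab hz hzs
    obtain ⟨h1, h2, -⟩ := hB z hz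
    obtain ⟨t, ⟨ht0, ht1⟩, rfl⟩ := mem_seg_iff.1 hzs
    have hl := height_lineMap r a b t
    have h3 := hstrip a b hab _ h1
    have h4 := hstrip a b hab _ h2
    generalize height r (AffineMap.lineMap a b t) = y at *
    have h5 : ¬ (height r a ≤ y - δ ∧ height r b ≤ y - δ) := fun h => by
      nlinarith
    have h6 : ¬ (y + δ ≤ height r a ∧ y + δ ≤ height r b) := fun h => by
      nlinarith
    have h3 := h3.resolve_right h5
    have h4 := h4.resolve_left h6
    rw [abs_le, abs_le]
    exact ⟨⟨by linarith, by linarith⟩, ⟨by linarith, by linarith⟩⟩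
  have hnear' : ∀ {e z p}, e ∈ D₁.edges → z ∈ D₁.crossings → z ∈ seg e → p ∈ seg e →
      |height r p - height r z| ≤ δ := by
    intro e z p he hz hze hpe
    induction e using Sym2.ind with
    | _ a b =>
    obtain ⟨h1, h2⟩ := hnear he hz hze
    obtain ⟨t, ⟨ht0, ht1⟩, rfl⟩ := mem_seg_iff.1 hpe
    rw [height_lineMap]
    rw [abs_le] at *
    constructor <;> nlinarith
  have heq : ∀ {e z w}, e ∈ D₁.edges → z ∈ D₁.crossings → w ∈ D₁.crossings → z ∈ seg e →
      w ∈ seg e → z = w := by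
    intro e z w he hz hw hze hwe
    by_contra hzw
    have h1 := hnear' he hw hwe hze
    have h2 := hgap z hz w hw hzw
    linarith
  have huniq : ∀ {e f g}, D₁.Linked e f → g ∈ D₁.edges → Crosses e g → f = g := by
    intro e f g hl hg hc
    by_contra hfg
    obtain ⟨he, hf, hc'⟩ := hl.mem
    obtain ⟨x, hxe, hxf⟩ := hc'.2
    obtain ⟨y, hye, hyg⟩ := hc.2
    obtain rfl := heq he ⟨e, he, f, hf, hc', hxe, hxf⟩ ⟨e, he, g, hg, hc, hye, hyg⟩ hxe hye
    have := D₁.no_triple e he f hf g hg hc'.ne hfg hc.ne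
    exact Set.eq_empty_iff_forall_notMem.1 this x ⟨⟨hxe, hxf⟩, hyg⟩
  -- the crossing on a classical edge
  have hpt : ∀ {e}, D₁.IsClassical e → ∃ z ∈ D₁.crossings, z ∈ seg e := by
    rintro e ⟨f, hf⟩
    obtain ⟨x, hxe, hxf⟩ := hf.mem.2.2.2
    exact ⟨x, mem_crossings_of_linked hf hxe hxf, hxe⟩
  have hnot : ∀ {e f}, D₁.IsClassical e → D₁.IsClassical f → e ≠ f → ∀ p ∈ e, p ∉ f := by
    intro e f he hf hef p hpe hpf
    obtain ⟨z, hz, hze⟩ := hpt he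
    obtain ⟨w, hw, hwf⟩ := hpt hf
    have h1 := hnear' he.mem hz hze (mem_seg_of_mem hpe)
    have h2 := hnear' hf.mem hw hwf (mem_seg_of_mem hpf)
    -- Two classical edges with a common end point lie in the same strip, so their crossings agree.
    -- Both edges then contain `z` and the end point, which forces a vertex at a crossing.
    have hzw : z = w := by
      by_contra hzw
      have h3 := hgap z hz w hw hzw
      have h4 := abs_sub_le (height r z) (height r p) (height r w)
      rw [abs_sub_comm] at h1
      linarith
    subst hzw
    have hpz : p = z := D₁.edge_generic _ he.mem _ hf.mem hef
      ⟨mem_seg_of_mem hpe, mem_seg_of_mem hpf⟩ ⟨hze, hwf⟩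
    subst hpz
    exact notMem_of_mem_crossings hz he.mem hpe
  have hslope : ∀ {a b z}, s(a, b) ∈ D₁.edges → z ∈ D₁.crossings → z ∈ seg s(a, b) →
      ramp B (height r b) - ramp B (height r a) =
        (B.filter (· < height r z)).card * (height r b - height r a) := by
    intro a b z hab hz hze
    refine ramp_sub fun β hβ => ?_
    obtain ⟨t, ⟨ht0, ht1⟩, rfl⟩ := mem_seg_iff.1 hze
    have hl := height_lineMap r a b t
    have hzB := (hB _ hz).2.2
    have hne : height r (AffineMap.lineMap a b t) ≠ β := fun h => hzB (h ▸ hβ)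
    generalize height r (AffineMap.lineMap a b t) = y at *
    rcases hstrip a b hab β hβ with ⟨h1, h2⟩ | ⟨h1, h2⟩
    · exact Or.inl ⟨lt_of_le_of_ne (by nlinarith) hne.symm, h1, h2⟩
    · exact Or.inr ⟨by nlinarith, h1, h2⟩
  -- The break point `height r z + δ` separates the two crossings, so the slope of the ramp is
  -- strictly larger at the higher one.
  have hcard : ∀ {z w}, height r z < height r w →
      z ∈ D₁.crossings → w ∈ D₁.crossings →
      (B.filter (· < height r z)).card < (B.filter (· < height r w)).card := by
    intro z w hlt hz hw
    refine Finset.card_lt_card ((Finset.ssubset_iff_of_subset ?_).2 ⟨height r z + δ, ?_, ?_⟩)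
    · intro β hβ
      rw [Finset.mem_filter] at hβ ⊢
      exact ⟨hβ.1, hβ.2.trans hlt⟩
    · rw [Finset.mem_filter]
      refine ⟨(hB z hz).2.1, ?_⟩
      have h1 := hgap z hz w hw (by rintro rfl; exact lt_irrefl _ hlt)
      rw [abs_of_neg (by linarith)] at h1
      linarith
    · rw [Finset.mem_filter]
      rintro ⟨-, h⟩
      linarith
  -- As a function of `s` the determinant is affine and not identically zero. For edges through the
  -- same crossing the constant term is nonzero by transversality; for different crossings the
  -- linear coefficient is nonzero, since the two strips are sheared with different slopes.
  have hlin : ∀ {a b c d}, D₁.IsClassical s(a, b) → D₁.IsClassical s(c, d) → s(a, b) ≠ s(c, d) →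
      ∃ m k : ℝ, (m ≠ 0 ∨ k ≠ 0) ∧ ∀ s,
        cross (shear r B s b - shear r B s a) (shear r B s d - shear r B s c) = m + s * k := by
    intro a b c d he hf hef
    obtain ⟨z, hz, hze⟩ := hpt he
    obtain ⟨w, hw, hwf⟩ := hpt hf
    refine ⟨_, _, ?_, cross_shear (hslope he.mem hz hze) (hslope hf.mem hw hwf)⟩
    by_cases hzw : z = w
    · subst hzw
      exact Or.inl (D₁.cross_ne_zero he.mem hf.mem (D₁.crosses_of_mem he.mem hf.mem hef hze hwf
        (Or.inl (notMem_of_mem_crossings hz he.mem))))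
    · refine Or.inr (mul_ne_zero (mul_ne_zero ?_ (sub_ne_zero.2 (hne a b he.mem).symm))
        (sub_ne_zero.2 (hne c d hf.mem).symm))
      rw [sub_ne_zero, Nat.cast_injective.ne_iff]
      have h1 : height r z ≠ height r w := by
        intro h
        have := hgap z hz w hw hzw
        rw [h, sub_self, abs_zero] at this
        linarith
      rcases lt_or_gt_of_ne h1 with h1 | h1
      · exact (hcard h1 hz hw).ne'
      · exact (hcard h1 hw hz).ne
  obtain ⟨s, hs⟩ : ∃ s, ∀ {a b c d}, D₁.IsClassical s(a, b) → D₁.IsClassical s(c, d) →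
      s(a, b) ≠ s(c, d) →
      cross (shear r B s b - shear r B s a) (shear r B s d - shear r B s c) ≠ 0 := by
    have hfin : (⋃ a ∈ D₁.vertices, ⋃ b ∈ D₁.vertices, ⋃ c ∈ D₁.vertices, ⋃ d ∈ D₁.vertices,
        {s | (D₁.IsClassical s(a, b) ∧ D₁.IsClassical s(c, d) ∧ s(a, b) ≠ s(c, d)) ∧
          cross (shear r B s b - shear r B s a) (shear r B s d - shear r B s c) = 0}).Finite := by
      have hV := D₁.vertices_finite
      refine hV.biUnion fun a _ => hV.biUnion fun b _ => hV.biUnion fun c _ => hV.biUnion fun d _ =>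
        Set.Subsingleton.finite ?_
      rintro s ⟨⟨h1, h2, h3⟩, h4⟩ t ⟨-, h5⟩
      obtain ⟨m, k, hmk, h⟩ := hlin h1 h2 h3
      rw [h] at h4 h5
      have h6 : (s - t) * k = 0 := by linear_combination h4 - h5
      rcases mul_eq_zero.1 h6 with h6 | h6
      · linarith
      · rw [h6, mul_zero, add_zero] at h4
        tauto
    obtain ⟨s, hs⟩ := hfin.infinite_compl.nonempty
    refine ⟨s, fun {a b c d} h1 h2 h3 h4 => hs ?_⟩
    simp only [Set.mem_iUnion]
    exact ⟨a, ⟨_, h1.mem, by simp⟩, b, ⟨_, h1.mem, by simp⟩, c, ⟨_, h2.mem, by simp⟩,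
      d, ⟨_, h2.mem, by simp⟩, ⟨h1, h2, h3⟩, h4⟩
  have hφ : Function.Injective (shear r B s) := (shearHomeo r B s).injective
  have himg : ∀ e ∈ D₁.edges, shear r B s '' seg e = seg (e.map (shear r B s)) := by
    intro e he
    induction e using Sym2.ind with
    | _ a b => exact image_seg fun t ht => shear_lineMap (hstrip a b he) s ht
  refine ⟨D₁.map hφ himg, Setoid.trans hsub.equiv (equiv_of_move (Or.inl ?_)), ?_,
    D₁.separated_map hφ himg ?_ ?_ hnot hs⟩
  · refine D₁.isotopic_map hφ himg (fun t => shearHomeo r B (t * s)) ?_ ?_ ?_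
    · exact (continuous_shear r B).comp
        (by fun_prop : Continuous fun q : I × Plane => ((q.1 : ℝ) * s, q.2))
    · ext1 p
      change shear r B (((0 : I) : ℝ) * s) p = p
      simp [shear_zero]
    · funext p
      change shear r B (((1 : I) : ℝ) * s) p = shear r B s p
      simp
  · rw [numClassical_map, numClassical, hsub.classicalCrossings_eq, numClassical]
  · exact fun hf hg => huniq hf hg.mem.2.1 hg.mem.2.2
  · rintro e f ⟨g, hg⟩ hf hc
    obtain rfl := huniq hg hf.mem hc
    exact hg

end Diagram
end VirtualKnot

/-! ### Replacing an arc by a segment. -/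

namespace VirtualKnot

theorem closedEdges_split (p q : Plane) (M S : List Plane) :
    closedEdges (p :: M ++ q :: S) = pathEdges (p :: M ++ [q]) ∪ pathEdges (q :: S ++ [p]) := by
  have h : closedEdges (p :: M ++ q :: S) = pathEdges ((p :: M) ++ q :: (S ++ [p])) := by
    simp [closedEdges]
  rw [h, pathEdges_append]
  simp

/-- The end points of a polygonal path with at least two edges are not joined by an edge. -/
theorem notMem_pathEdges {p q : Plane} {M : List Plane} (hM : M ≠ []) (h : (p :: M ++ [q]).Nodup) :
    s(p, q) ∉ pathEdges (p :: M ++ [q]) := by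
  cases M with
  | nil => exact absurd rfl hM
  | cons m M =>
    simp only [List.cons_append, List.nodup_cons, List.mem_cons, List.mem_append, not_or] at h
    rintro (he | he)
    · rcases Sym2.eq_iff.1 he with ⟨-, rfl⟩ | ⟨rfl, -⟩ <;> simp at h
    · have := mem_of_mem_pathEdges he (p := p) (by simp)
      simp at this
      simp at h
      tauto

/-- The two arcs share only the vertices `p` and `q`. A common edge would have to be `pq`, which the
first arc avoids since it has an interior vertex. -/
theorem disjoint_pathEdges {p q : Plane} {M S : List Plane} (hM : M ≠ [])
    (h : (p :: M ++ q :: S).Nodup) :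
    Disjoint (pathEdges (p :: M ++ [q])) (pathEdges (q :: S ++ [p])) := by
  rw [Set.disjoint_left]
  intro e he hf
  have hpq : (p :: M ++ [q]).Nodup := by
    refine h.sublist ?_
    simp
  have hd : ¬ e.IsDiag := by
    have : e ∈ closedEdges (p :: M ++ q :: S) := by rw [closedEdges_split]; exact Or.inl he
    induction e using Sym2.ind with
    | _ u v =>
      rw [Sym2.mk_isDiag_iff]
      exact ne_of_mem_closedEdges h (by simp; omega) this
  have hmem : ∀ x ∈ e, x = p ∨ x = q := by
    intro x hx
    have h1 := mem_of_mem_pathEdges he hx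
    have h2 := mem_of_mem_pathEdges hf hx
    simp only [List.cons_append, List.nodup_cons, List.nodup_append, List.mem_cons,
      List.mem_append, List.not_mem_nil, or_false] at h h1 h2
    by_contra hcon
    rw [not_or] at hcon
    have h3 : x ∈ M := by tauto
    have h4 : x ∈ S := by tauto
    exact h.2.2.2 x h3 x (Or.inr h4) rfl
  apply notMem_pathEdges hM hpq
  convert he using 1
  induction e using Sym2.ind with
  | _ u v =>
    rw [Sym2.mk_isDiag_iff] at hd
    rcases hmem u (by simp) with rfl | rfl <;> rcases hmem v (by simp) with rfl | rfl
    · exact absurd rfl hd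
    · rfl
    · exact Sym2.eq_swap
    · exact absurd rfl hd

theorem exists_mem_closedEdges {L : List Plane} {z : Plane} (hz : z ∈ L) :
    ∃ e ∈ closedEdges L, z ∈ e := by
  obtain ⟨i, hi, rfl⟩ := List.mem_iff_getElem.1 hz
  refine ⟨edgeAt L i, edgeAt_mem (List.ne_nil_of_mem hz) i, ?_⟩
  rw [edgeAt, vertexAt_of_lt hi]
  simp

namespace Diagram

theorem linked_congr {D D' : Diagram} (h : D'.isOver = D.isOver) : D'.Linked = D.Linked := by
  funext e f
  rw [Linked, Linked, h]

/-- Separatedness depends on a diagram only through its markings. -/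
theorem Separated.congr {D D' : Diagram} (h : D'.isOver = D.isOver) (hD : D.Separated) :
    D'.Separated := by
  have h1 := linked_congr h
  have h2 : D'.IsClassical = D.IsClassical := by funext e; rw [IsClassical, IsClassical, h1]
  refine ⟨?_, ?_, ?_, ?_⟩
  · rw [h1]; exact hD.linked_unique
  · rw [h1, h2]; exact hD.linked_of_crosses
  · rw [h2]; exact hD.notMem
  · rw [h2]; exact hD.cross_ne

theorem numClassical_congr {D D' : Diagram} (h : D'.isOver = D.isOver) :
    D'.numClassical = D.numClassical := by
  rw [numClassical, numClassical, classicalCrossings, classicalCrossings, h]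

/-- An arc without classical crossings may be replaced by a segment in general position. -/
theorem exists_detour (D : Diagram) {p q : Plane} {M S : List Plane} (hM : M ≠ []) (hS : S ≠ [])
    (hL : (p :: M ++ q :: S).Nodup) (hD : D.edges = closedEdges (p :: M ++ q :: S))
    (hpath : ∀ e ∈ pathEdges (p :: M ++ [q]), ¬ D.IsClassical e)
    (hvert : ∀ z ∈ D.vertices, z ∈ seg s(p, q) → z = p ∨ z = q)
    (hsub : ∀ g ∈ pathEdges (q :: S ++ [p]), (seg s(p, q) ∩ seg g).Subsingleton)
    (htri : ∀ g ∈ pathEdges (q :: S ++ [p]), ∀ k ∈ pathEdges (q :: S ++ [p]), g ≠ k →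
      ∀ z ∈ seg g, z ∈ seg k → z ∉ seg s(p, q)) :
    ∃ D' : Diagram, D ≈ D' ∧ D'.edges = closedEdges (p :: q :: S) ∧ D'.isOver = D.isOver := by
  have hdisj := disjoint_pathEdges hM hL
  rw [closedEdges_split] at hD
  have hrest : pathEdges (q :: S ++ [p]) ⊆ D.edges := hD ▸ Set.subset_union_right
  have hpathD : pathEdges (p :: M ++ [q]) ⊆ D.edges := hD ▸ Set.subset_union_left
  have hN₁ : s(p, q) ∉ pathEdges (p :: M ++ [q]) := by
    refine notMem_pathEdges hM (hL.sublist ?_)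
    simp
  have hN₂ : s(p, q) ∉ pathEdges (q :: S ++ [p]) := by
    rw [Sym2.eq_swap]
    refine notMem_pathEdges hS ?_
    have : (q :: S ++ p :: M).Nodup := List.nodup_append_comm.1 hL
    refine this.sublist ?_
    simp
  have hdiff : D.edges \ pathEdges (p :: M ++ [q]) = pathEdges (q :: S ++ [p]) := by
    rw [hD, Set.union_sdiff_left, hdisj.symm.sdiff_eq_left]
  -- All classical edges lie outside the arc, so the new diagram can keep the relation `D.isOver`
  -- unchanged. All crossings on the new segment then become virtual.
  have hover : ∀ e, D.IsClassical e → e ∈ pathEdges (q :: S ++ [p]) := fun e he =>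
    hdiff ▸ ⟨he.mem, fun h => hpath e h he⟩
  have hvp : p ∈ D.vertices := by
    obtain ⟨e, he, hp⟩ := exists_mem_closedEdges (L := p :: M ++ q :: S) (z := p) (by simp)
    exact ⟨e, by rwa [hD, ← closedEdges_split], hp⟩
  have hvq : q ∈ D.vertices := by
    obtain ⟨e, he, hp⟩ := exists_mem_closedEdges (L := p :: M ++ q :: S) (z := q) (by simp)
    exact ⟨e, by rwa [hD, ← closedEdges_split], hp⟩
  have hclosed : closedEdges (p :: q :: S) = insert s(p, q) (pathEdges (q :: S ++ [p])) := by
    rw [closedEdges_cons]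
    simp [pathEdges]
  let D' : Diagram :=
    { edges := insert s(p, q) (pathEdges (q :: S ++ [p]))
      isOver := D.isOver
      closed_polygon := by
        refine ⟨p, q :: S, ?_, ?_, by rw [← closedEdges_cons, hclosed]⟩
        · refine hL.sublist ?_
          simp
        · have := List.length_pos_of_ne_nil hS
          simp
          omega
      vertex_generic := by
        have hv : ∀ e ∈ insert s(p, q) (pathEdges (q :: S ++ [p])), ∀ z ∈ e, z ∈ D.vertices := by
          rintro e (rfl | he) z hz
          · rcases Sym2.mem_iff.1 hz with rfl | rfl
            · exact hvp
            · exact hvq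
          · exact ⟨e, hrest he, hz⟩
        rintro e he f (rfl | hf) z hz hzf
        · exact Sym2.mem_iff.2 (hvert z (hv e he z hz) hzf)
        · obtain ⟨g, hg, hzg⟩ := hv e he z hz
          exact D.vertex_generic g hg f (hrest hf) z hzg hzf
      edge_generic := by
        rintro e (rfl | he) f (rfl | hf) hef
        · exact absurd rfl hef
        · exact hsub f hf
        · rw [Set.inter_comm]
          exact hsub e he
        · exact D.edge_generic e (hrest he) f (hrest hf) hef
      no_triple := by
        intro e he f hf g hg hef hfg heg
        rw [Set.eq_empty_iff_forall_notMem]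
        rintro z ⟨⟨hze, hzf⟩, hzg⟩
        rcases he with rfl | he
        · exact htri f (hf.resolve_left hef.symm) g (hg.resolve_left heg.symm) hfg z hzf hzg hze
        rcases hf with rfl | hf
        · exact htri e he g (hg.resolve_left hfg.symm) heg z hze hzg hzf
        rcases hg with rfl | hg
        · exact htri e he f hf hef z hze hzf hzg
        exact Set.eq_empty_iff_forall_notMem.1 (D.no_triple e (hrest he) f (hrest hf) g (hrest hg)
          hef hfg heg) z ⟨⟨hze, hzf⟩, hzg⟩
      over_crosses := fun e f h => ⟨Or.inr (hover e ⟨f, Or.inl h⟩), Or.inr (hover f ⟨e, Or.inr h⟩),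
        (D.over_crosses e f h).2.2⟩
      over_asymm := D.over_asymm }
  refine ⟨D', equiv_of_move (Or.inr (Or.inr (Or.inr (Or.inr ?_)))), hclosed.symm, rfl⟩
  refine ⟨p :: M ++ [q], [p, q], ⟨?_, ?_, by simp, by rw [List.getLast?_concat]; rfl, hpathD, ?_, ?_, fun e _ f _ => Iff.rfl⟩,
    ?_, ?_⟩
  · exact hL.sublist (by simp)
  · exact hL.sublist (by simp)
  · intro e he
    simp only [pathEdges, insert_empty_eq, Set.mem_singleton_iff] at he
    exact Or.inl he
  · rw [hdiff]
    change _ = insert s(p, q) (pathEdges (q :: S ++ [p])) \ _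
    simp only [pathEdges, insert_empty_eq]
    rw [Set.insert_sdiff_of_mem _ (Set.mem_singleton _), Set.sdiff_singleton_eq_self hN₂]
  · exact fun e he f => ⟨fun h => hpath e he ⟨f, Or.inl h⟩, fun h => hpath e he ⟨f, Or.inr h⟩⟩
  · intro e he f
    simp only [pathEdges, insert_empty_eq, Set.mem_singleton_iff] at he
    subst he
    exact ⟨fun h => hN₂ (hover _ ⟨f, Or.inl h⟩), fun h => hN₂ (hover _ ⟨f, Or.inr h⟩)⟩

end Diagram
end VirtualKnot

/-! ### Generic chords, and shortening a separated diagram. -/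

namespace VirtualKnot

theorem mem_seg_of_mem_openSegment {a b c : Plane} (h : c ∈ openSegment ℝ a b) :
    c ∈ seg s(a, b) := seg_mk a b ▸ openSegment_subset_segment ℝ a b h

/-- If `x` is in the open segment `ab` and `c` in the open segment `xb`, then `c` is in the open
segment `ab`, and `x` is in the segment `ac`. -/
theorem openSegment_trans {a b x c : Plane} (hx : x ∈ openSegment ℝ a b)
    (hc : c ∈ openSegment ℝ x b) : c ∈ openSegment ℝ a b ∧ x ∈ seg s(a, c) := by
  rw [openSegment_eq_image_lineMap] at hx hc
  obtain ⟨t, ⟨ht0, ht1⟩, rfl⟩ := hx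
  obtain ⟨s, ⟨hs0, hs1⟩, rfl⟩ := hc
  have h1 : t + s * (1 - t) < 1 := by nlinarith
  have h0 : 0 < t + s * (1 - t) := by nlinarith
  have h2 : (AffineMap.lineMap (AffineMap.lineMap a b t : Plane) b s : Plane) =
      AffineMap.lineMap a b (t + s * (1 - t)) := by
    simp only [AffineMap.lineMap_apply, vsub_eq_sub, vadd_eq_add]
    module
  rw [h2]
  constructor
  · rw [openSegment_eq_image_lineMap]
    exact ⟨_, ⟨h0, h1⟩, rfl⟩
  · refine mem_seg_iff.2 ⟨t / (t + s * (1 - t)), ⟨by positivity, ?_⟩, ?_⟩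
    · rw [div_le_one h0]
      nlinarith
    · have h3 : t = t / (t + s * (1 - t)) * (t + s * (1 - t)) := by field_simp
      conv_rhs => rw [h3]
      simp only [AffineMap.lineMap_apply, vsub_eq_sub, vadd_eq_add]
      module

theorem cross_eq_side_sub (a b c d : Plane) : cross (b - a) (d - c) = side a b d - side a b c := by
  simp only [cross, side, Prod.fst_sub, Prod.snd_sub]; ring

namespace Diagram

/-- The common points of different edges, and the vertices. -/
def specialPoints (D : Diagram) : Set Plane :=
  (⋃ e ∈ D.edges, ⋃ f ∈ D.edges, {z | e ≠ f ∧ z ∈ seg e ∩ seg f}) ∪ D.vertices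

theorem specialPoints_finite (D : Diagram) : D.specialPoints.Finite := by
  refine Set.Finite.union (D.edges_finite.biUnion fun e he => D.edges_finite.biUnion fun f hf =>
    Set.Subsingleton.finite ?_) D.vertices_finite
  rintro x ⟨hef, hx⟩ y ⟨-, hy⟩
  exact D.edge_generic e he f hf hef hx hy

theorem mem_specialPoints (D : Diagram) {e f : Sym2 Plane} (he : e ∈ D.edges) (hf : f ∈ D.edges)
    (hef : e ≠ f) {z : Plane} (hze : z ∈ seg e) (hzf : z ∈ seg f) : z ∈ D.specialPoints := by
  left
  simp only [Set.mem_iUnion]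
  exact ⟨e, he, f, hf, hef, hze, hzf⟩

/-- Two skew edges can be shortened at one end each such that the segment between the new end
points is in general position with respect to the diagram. -/
theorem exists_generic_chord (D : Diagram) {p' p q q' x y : Plane} (hp : s(p', p) ∈ D.edges)
    (hq : s(q, q') ∈ D.edges) (hpar : cross (p - p') (q' - q) ≠ 0)
    (hx : x ∈ openSegment ℝ p' p) (hy : y ∈ openSegment ℝ q q') :
    ∃ p₁ ∈ openSegment ℝ x p, ∃ q₁ ∈ openSegment ℝ q y,
      p₁ ∉ D.specialPoints ∧ q₁ ∉ D.specialPoints ∧ p₁ ≠ q₁ ∧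
      (∀ z ∈ D.specialPoints, z ∉ seg s(p₁, q₁)) ∧
      (∀ g ∈ D.edges, (seg s(p₁, q₁) ∩ seg g).Subsingleton) := by
  have hpne := D.ne_of_mem hp
  have hqne := D.ne_of_mem hq
  have hxs := mem_seg_of_mem_openSegment hx
  have hys := mem_seg_of_mem_openSegment hy
  have hxp : x ≠ p := by
    rintro rfl
    exact (seg_split hpne hx).2.2.1 (False.elim (hpne (right_mem_openSegment_iff.1 hx)))
  have hqy : q ≠ y := by
    rintro rfl
    exact hqne (left_mem_openSegment_iff.1 hy)
  have hpm : p ∈ seg s(p', p) := mem_seg_of_mem (by simp)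
  have hqm : q ∈ seg s(q, q') := mem_seg_of_mem (by simp)
  -- `p₁` avoids every line through two vertices that does not contain the edge `p'p`. This includes
  -- the line `qq'`, since the edges are not parallel.
  obtain ⟨p₁, hp₁, hp₁F, hp₁S⟩ := exists_mem_openSegment hxp D.specialPoints_finite
    (S := {s | s ∈ D.vertices ×ˢ D.vertices ∧ (side s.1 s.2 p' ≠ 0 ∨ side s.1 s.2 p ≠ 0)})
    ((D.vertices_finite.prod D.vertices_finite).subset fun s hs => hs.1) (by
      rintro ⟨u, v⟩ ⟨-, h⟩
      by_contra hcon
      rw [not_or, not_not, not_not] at hcon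
      have := side_eq_zero_of_two hxs hpm hxp hcon.1 hcon.2
      tauto)
  have hqside : side q q' p₁ ≠ 0 := by
    refine hp₁S (q, q') ⟨⟨⟨_, hq, by simp⟩, ⟨_, hq, by simp⟩⟩, ?_⟩
    by_contra hcon
    rw [not_or, not_not, not_not] at hcon
    apply hpar
    have h1 := cross_eq_side_sub q q' p' p
    rw [hcon.1, hcon.2, sub_zero] at h1
    have h2 : cross (p - p') (q' - q) = -cross (q' - q) (p - p') := by
      simp only [cross]; ring
    rw [h2, h1, neg_zero]
  -- `q₁` avoids the line `p'p` and every line that joins `p₁` to a special point. None of the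
  -- latter is the line `qq'`, because `p₁` is not on it.
  obtain ⟨q₁, hq₁, hq₁F, hq₁S⟩ := exists_mem_openSegment hqy D.specialPoints_finite
    (S := insert (p', p) ((fun z => (z, p₁)) '' D.specialPoints))
    ((D.specialPoints_finite.image _).insert _) (by
      intro s hs
      by_contra hcon
      rw [not_or, not_not, not_not] at hcon
      have h1 := side_eq_zero_of_two hqm hys hqy hcon.1 hcon.2
      rcases hs with rfl | ⟨z, hz, rfl⟩
      · exact hpar (by rw [cross_eq_side_sub, h1.1, h1.2, sub_zero])
      · have hne : z ≠ p₁ := by rintro rfl; exact hp₁F hz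
        exact hqside (side_eq_zero_of_line hne h1.1 h1.2 (side_right z p₁)))
  have hside : side p' p q₁ ≠ 0 := hq₁S _ (Or.inl rfl)
  have hp₁s : p₁ ∈ seg s(p', p) := seg_subset hxs hpm (mem_seg_of_mem_openSegment hp₁)
  refine ⟨p₁, hp₁, q₁, hq₁, hp₁F, hq₁F, ?_, ?_, ?_⟩
  · rintro rfl
    exact hside (side_of_mem_seg hp₁s)
  · intro z hz hzs
    have h1 := side_of_mem_seg hzs
    rw [← side_rotate z] at h1
    exact hq₁S _ (Or.inr ⟨z, hz, rfl⟩) h1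
  · intro g hg
    induction g using Sym2.ind with
    | _ u v =>
    rintro z ⟨hz, hzg⟩ w ⟨hw, hwg⟩
    by_contra hzw
    obtain ⟨h1, h2⟩ := side_eq_zero_of_two hz hw hzw (side_of_mem_seg hzg) (side_of_mem_seg hwg)
    -- If the chord lay along the edge `uv`, then `p₁` and `q₁` would be on that line. Either `p₁`
    -- was chosen off it, or it is the line `p'p`, which `q₁` avoids.
    by_cases h3 : side u v p' ≠ 0 ∨ side u v p ≠ 0
    · exact hp₁S (u, v) ⟨⟨⟨_, hg, by simp⟩, ⟨_, hg, by simp⟩⟩, h3⟩ h1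
    · rw [not_or, not_not, not_not] at h3
      exact hside (side_eq_zero_of_line (D.ne_of_mem hg) h3.1 h3.2 h2)

/-- An insertion leaves the other classical edges classical. -/
theorem IsInsertion.isClassical_of_mem {D D₁ : Diagram} {a b c : Plane}
    (h : IsInsertion D D₁ a b c) {e : Sym2 Plane} (he : e ∈ D₁.edges) (hc : D.IsClassical e) :
    D₁.IsClassical e := by
  obtain ⟨f, hf⟩ := hc
  obtain ⟨x, hxe, hxf⟩ := hf.mem.2.2.2
  exact h.isClassical_child he hf subset_rfl hxe hxf

/-- In a separated diagram, an arc between consecutive classical edges that consists of several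
edges can be replaced by a single edge. -/
theorem exists_shorter (D : Diagram) (hs : D.Separated) {p' p q q' : Plane} {A R : List Plane}
    (hL : (p' :: p :: A ++ q :: q' :: R).Nodup)
    (hD : D.edges = closedEdges (p' :: p :: A ++ q :: q' :: R))
    (hcp : D.IsClassical s(p', p)) (hcq : D.IsClassical s(q, q')) (hA : A ≠ [])
    (hpath : ∀ e ∈ pathEdges (p :: A ++ [q]), ¬ D.IsClassical e) :
    ∃ D' : Diagram, D ≈ D' ∧ D'.numClassical = D.numClassical ∧ D'.Separated ∧
      D'.edges.ncard < D.edges.ncard := by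
  have hpne := D.ne_of_mem hcp.mem
  have hqne := D.ne_of_mem hcq.mem
  have hne : s(p', p) ≠ s(q, q') := by
    intro h
    rcases Sym2.eq_iff.1 h with ⟨rfl, -⟩ | ⟨rfl, -⟩ <;> simp at hL
  have hpt : ∀ {a b}, D.IsClassical s(a, b) →
      ∃ x f, D.Linked s(a, b) f ∧ x ∈ openSegment ℝ a b ∧ x ∈ seg f := by
    rintro a b ⟨f, hf⟩
    obtain ⟨x, hxe, hxf⟩ := hf.mem.2.2.2
    have hx := notMem_of_mem_crossings (mem_crossings_of_linked hf hxe hxf) hf.mem.1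
    rw [Sym2.mem_iff, not_or] at hx
    rw [seg_mk] at hxe
    exact ⟨x, f, hf, mem_openSegment_of_ne_left_right (Ne.symm hx.1) (Ne.symm hx.2) hxe, hxf⟩
  obtain ⟨x, f, hlf, hx, hxf⟩ := hpt hcp
  obtain ⟨y, g, hlg, hy, hyg⟩ := hpt hcq
  obtain ⟨p₁, hp₁, q₁, hq₁, hp₁F, hq₁F, hpq, hchord, hchord'⟩ :=
    D.exists_generic_chord hcp.mem hcq.mem (hs.cross_ne hcp hcq hne) hx hy
  obtain ⟨hp₁o, hxp₁⟩ := openSegment_trans hx hp₁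
  obtain ⟨hq₁o, hyq₁⟩ : q₁ ∈ openSegment ℝ q q' ∧ y ∈ seg s(q₁, q') := by
    rw [openSegment_symm] at hy hq₁
    obtain ⟨h1, h2⟩ := openSegment_trans hy hq₁
    rw [openSegment_symm, Sym2.eq_swap]
    exact ⟨h1, h2⟩
  have hp₁s := mem_seg_of_mem_openSegment hp₁o
  have hq₁s := mem_seg_of_mem_openSegment hq₁o
  have hLmem : ∀ z ∈ p' :: p :: A ++ q :: q' :: R, z ∈ D.vertices := fun z hz => by
    obtain ⟨e, he, hze⟩ := exists_mem_closedEdges hz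
    exact ⟨e, hD ▸ he, hze⟩
  have hp₁L : p₁ ∉ p' :: p :: A ++ q :: q' :: R := fun h => hp₁F (Or.inr (hLmem _ h))
  have hq₁L : q₁ ∉ p' :: p :: A ++ q :: q' :: R := fun h => hq₁F (Or.inr (hLmem _ h))
  -- first insertion
  obtain ⟨D₁, hi₁, hD₁⟩ := D.exists_isInsertion (R := A ++ q :: q' :: R) hL (by simp) hD hp₁o
    fun g hg hgne hcg => hp₁F (D.mem_specialPoints hg hcp.mem hgne hcg hp₁s)
  have hqD₁ : s(q, q') ∈ D₁.edges := hi₁.mem_old hcq.mem hne.symm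
  -- second insertion
  obtain ⟨D₂, hi₂, hD₂⟩ := D₁.exists_isInsertion (a := q) (b := q') (c := q₁)
    (R := R ++ p' :: p₁ :: p :: A) (by
      refine (List.Perm.nodup_iff (List.perm_iff_count.2 fun z => ?_)).1
        (List.nodup_cons.2 ⟨hp₁L, hL⟩)
      simp only [List.count_cons, List.count_append]
      omega) (by simp)
    (by
      rw [hD₁]
      have := closedEdges_append_comm (p' :: p₁ :: p :: A) (q :: q' :: R)
      simpa using this) hq₁o
    (by
      intro g hg hgne hcg
      obtain ⟨g₀, hg₀, hgs⟩ := hi₁.exists_parent hg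
      by_cases hg₀' : g₀ = s(q, q')
      · subst hg₀'
        exact hne (hi₁.same_parent hg hqD₁ hgne hg₀ hgs subset_rfl).1.symm
      · exact hq₁F (D.mem_specialPoints hg₀ hcq.mem hg₀' (hgs hcg) hq₁s))
  have hD₂' : D₂.edges = closedEdges (p₁ :: (p :: A ++ [q]) ++ q₁ :: (q' :: R ++ [p'])) := by
    rw [hD₂]
    have := closedEdges_append_comm (q :: q₁ :: q' :: R ++ [p']) (p₁ :: p :: A)
    have h2 := closedEdges_append_comm (p₁ :: p :: A ++ [q]) (q₁ :: q' :: R ++ [p'])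
    have h3 := closedEdges_append_comm [q] (q₁ :: q' :: R ++ [p'] ++ p₁ :: p :: A)
    simp only [List.cons_append, List.append_assoc, List.nil_append] at h2 h3 ⊢
    rw [h2, h3]
  have hs₂ : D₂.Separated := hi₂.separated (hi₁.separated hs)
  have hL₂ : (p₁ :: (p :: A ++ [q]) ++ q₁ :: (q' :: R ++ [p'])).Nodup := by
    have h : (p₁ :: q₁ :: (p' :: p :: A ++ q :: q' :: R)).Nodup := by
      refine List.nodup_cons.2 ⟨?_, List.nodup_cons.2 ⟨hq₁L, hL⟩⟩
      rw [List.mem_cons, not_or]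
      exact ⟨hpq, hp₁L⟩
    refine (List.Perm.nodup_iff (List.perm_iff_count.2 fun z => ?_)).1 h
    simp only [List.count_cons, List.count_append, List.count_nil]
    omega
  -- the two classical edges at the ends of the arc
  have hcp₂ : D₂.IsClassical s(p', p₁) := by
    refine hi₂.isClassical_of_mem (hi₂.mem_old hi₁.mem_left ?_)
      (hi₁.isClassical_child hi₁.mem_left hlf hi₁.seg_left hxp₁ hxf)
    intro h
    rcases Sym2.eq_iff.1 h with ⟨rfl, -⟩ | ⟨rfl, -⟩ <;> simp at hL
  have hcq₂ : D₂.IsClassical s(q₁, q') := by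
    obtain ⟨g', hg', hyg', hgs', -⟩ := hi₁.exists_child hlg.mem.2.1 hyg
    have : D₁.Linked s(q, q') g' :=
      hi₁.linked_child hqD₁ hg' hlg subset_rfl hgs' (mem_seg_of_mem_openSegment hy) hyg'
    exact hi₂.isClassical_child hi₂.mem_right this hi₂.seg_right hyq₁ hyg'
  have hpath₂ : ∀ e ∈ pathEdges (p₁ :: (p :: A ++ [q]) ++ [q₁]), ¬ D₂.IsClassical e := by
    have h1 : pathEdges (p₁ :: (p :: A ++ [q]) ++ [q₁]) =
        insert s(p₁, p) (pathEdges (p :: A ++ [q]) ∪ {s(q, q₁)}) := by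
      have := pathEdges_append (p :: A) [q₁] q
      simp only [List.cons_append, List.append_assoc, List.nil_append, pathEdges,
        insert_empty_eq] at this ⊢
      rw [this]
    rw [h1]
    rintro e (rfl | he | rfl) hc
    · refine hs₂.notMem hcp₂ hc ?_ p₁ (by simp) (by simp)
      intro h
      rcases Sym2.eq_iff.1 h with ⟨rfl, -⟩ | ⟨rfl, -⟩
      · simp at hp₁L
      · exact hpne rfl
    · have heD : e ∈ D.edges := by
        rw [hD]
        have h2 := closedEdges_split p q A (q' :: R ++ [p'])
        have h3 := closedEdges_append_comm [p'] (p :: A ++ q :: q' :: R)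
        simp only [List.cons_append, List.append_assoc, List.nil_append] at h2 h3 he ⊢
        rw [h3, h2]
        exact Or.inl he
      refine hpath e he (hi₁.isClassical_old heD (hi₂.isClassical_old (hi₁.mem_old heD ?_) hc))
      rintro rfl
      exact hpath _ he hcp
    · refine hs₂.notMem hcq₂ hc ?_ q₁ (by simp) (by simp)
      intro h
      rcases Sym2.eq_iff.1 h with ⟨rfl, -⟩ | ⟨-, rfl⟩
      · simp at hq₁L
      · exact hqne rfl
  -- the edges outside the arc, and the edges of `D` that contain them
  have hparent : ∀ g ∈ pathEdges (q₁ :: (q' :: R ++ [p']) ++ [p₁]), ∃ g₀ ∈ D.edges,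
      seg g ⊆ seg g₀ ∧ ((g = s(q₁, q') ∧ g₀ = s(q, q')) ∨ (g = s(p', p₁) ∧ g₀ = s(p', p)) ∨
        (g = g₀ ∧ g₀ ≠ s(q, q') ∧ g₀ ≠ s(p', p))) := by
    have h1 : pathEdges (q₁ :: (q' :: R ++ [p']) ++ [p₁]) =
        insert s(q₁, q') (pathEdges (q' :: R ++ [p']) ∪ {s(p', p₁)}) := by
      have := pathEdges_append (q' :: R) [p₁] p'
      simp only [List.cons_append, List.append_assoc, List.nil_append, pathEdges,
        insert_empty_eq] at this ⊢
      rw [this]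
    rw [h1]
    rintro g (rfl | hg | rfl)
    · exact ⟨_, hcq.mem, hi₂.seg_right, Or.inl ⟨rfl, rfl⟩⟩
    · refine ⟨g, ?_, subset_rfl, Or.inr (Or.inr ⟨rfl, ?_, ?_⟩)⟩
      · rw [hD]
        have h2 := closedEdges_append_comm (p' :: p :: A ++ [q]) (q' :: R)
        have h3 := closedEdges_split q' p' R (p :: A ++ [q])
        simp only [List.cons_append, List.append_assoc, List.nil_append] at h2 h3 hg ⊢
        rw [h2, h3]
        exact Or.inl hg
      · rintro rfl
        have := mem_of_mem_pathEdges hg (p := q) (by simp)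
        simp only [List.cons_append, List.nodup_cons, List.nodup_append, List.mem_cons,
          List.mem_append, not_or] at hL this
        grind
      · rintro rfl
        have := mem_of_mem_pathEdges hg (p := p) (by simp)
        simp only [List.cons_append, List.nodup_cons, List.nodup_append, List.mem_cons,
          List.mem_append, not_or] at hL this
        grind
    · exact ⟨_, hcp.mem, hi₁.seg_left, Or.inr (Or.inl ⟨rfl, rfl⟩)⟩
  obtain ⟨D₃, he₃, hD₃, ho₃⟩ := D₂.exists_detour (by simp) (by simp) hL₂ hD₂' hpath₂
    (by
      intro z hz hzs
      rw [hi₂.vertices_eq, hi₁.vertices_eq] at hz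
      rcases hz with rfl | rfl | hz
      · exact Or.inr rfl
      · exact Or.inl rfl
      · exact absurd hzs (hchord z (Or.inr hz)))
    (by
      intro g hg
      obtain ⟨g₀, hg₀, hgs, -⟩ := hparent g hg
      exact (hchord' g₀ hg₀).anti (Set.inter_subset_inter subset_rfl hgs))
    (by
      intro g hg k hk hgk z hzg hzk
      obtain ⟨g₀, hg₀, hgs, h1⟩ := hparent g hg
      obtain ⟨k₀, hk₀, hks, h2⟩ := hparent k hk
      -- Outside the arc each edge of `D` has at most one child, since the other halves of the two
      -- trimmed edges belong to the arc. The parents thus differ, and their common point is a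
      -- special point, which the chord avoids.
      refine hchord z (D.mem_specialPoints hg₀ hk₀ ?_ (hgs hzg) (hks hzk))
      rintro rfl
      grind)
  refine ⟨D₃, Setoid.trans (Setoid.trans hi₁.equiv hi₂.equiv) he₃, ?_, hs₂.congr ho₃, ?_⟩
  · rw [numClassical_congr ho₃, numClassical, hi₂.classicalCrossings_eq, hi₁.classicalCrossings_eq,
      numClassical]
  · have hL₃ : (p₁ :: q₁ :: (q' :: R ++ [p'])).Nodup := 
      hL₂.sublist (List.Sublist.cons_cons _ (List.sublist_append_right _ _))
    -- The vertices `p`, `q` are traded for `p₁`, `q₁`, and those in `A` disappear, so the loss is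
    -- the length of `A`.
    rw [hD₃, hD, closedEdges_ncard hL₃ (by simp), closedEdges_ncard hL (by simp; omega)]
    have := List.length_pos_of_ne_nil hA
    simp
    omega

end Diagram
end VirtualKnot

/-! ### Diagrams without classical crossings. -/

namespace VirtualKnot

theorem subsingleton_of_side_ne {a b c : Plane} (h : side a b c ≠ 0) :
    (seg s(a, b) ∩ seg s(a, c)).Subsingleton := by
  rintro z ⟨hz1, hz2⟩ w ⟨hw1, hw2⟩
  by_contra hzw
  exact h (side_eq_zero_of_two hz2 hw2 hzw (side_of_mem_seg hz1) (side_of_mem_seg hw1)).2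

namespace Diagram

/-- Any two edges of a triangle share a vertex, so there are no crossings of either kind. -/
theorem exists_triangle {p q c : Plane} (h : side p q c ≠ 0) :
    ∃ D : Diagram, D.edges = closedEdges [p, c, q] ∧ (∀ e f, ¬ D.isOver e f) ∧
      D.numTotal = 0 := by
  have h1 : side q c p ≠ 0 := by rwa [← side_rotate]
  have h2 : side c p q ≠ 0 := by rwa [side_rotate]
  have hE : closedEdges [p, c, q] = {s(p, c), s(c, q), s(q, p)} := by
    simp [closedEdges, pathEdges]
  have hpc : p ≠ c := by rintro rfl; simp at h
  have hqc : q ≠ c := by rintro rfl; simp at h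
  have hpq : p ≠ q := by rintro rfl; simp at h
  have hp : p ∉ seg s(c, q) := fun hh => h1 (by rw [Sym2.eq_swap] at hh; exact side_of_mem_seg hh)
  have hc : c ∉ seg s(q, p) := fun hh => h (by rw [Sym2.eq_swap] at hh; exact side_of_mem_seg hh)
  have hq : q ∉ seg s(p, c) := fun hh => h2 (by rw [Sym2.eq_swap] at hh; exact side_of_mem_seg hh)
  have s1 : (seg s(p, c) ∩ seg s(c, q)).Subsingleton := by
    rw [Sym2.eq_swap (a := p)]; exact subsingleton_of_side_ne h2
  have s2 : (seg s(c, q) ∩ seg s(q, p)).Subsingleton := by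
    rw [Sym2.eq_swap (a := c)]; exact subsingleton_of_side_ne h1
  have s3 : (seg s(q, p) ∩ seg s(p, c)).Subsingleton := by
    rw [Sym2.eq_swap (a := q)]; exact subsingleton_of_side_ne h
  have htri : ∀ z, z ∈ seg s(p, c) → z ∈ seg s(c, q) → z ∈ seg s(q, p) → False := by
    intro z hz1 hz2 hz3
    have : z = c := s1 ⟨hz1, hz2⟩ ⟨mem_seg_of_mem (by simp), mem_seg_of_mem (by simp)⟩
    exact hc (this ▸ hz3)
  have hshare : ∀ e ∈ closedEdges [p, c, q], ∀ f ∈ closedEdges [p, c, q], ¬ Crosses e f := by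
    rw [hE]
    rintro e (rfl | rfl | rfl) f (rfl | rfl | rfl) ⟨hcr, -⟩ <;> simp at hcr
  let D : Diagram :=
    { edges := closedEdges [p, c, q]
      isOver := fun _ _ => False
      closed_polygon := ⟨p, [c, q], by simp [hpc, hpq, hqc.symm], by simp, closedEdges_cons _ _⟩
      vertex_generic := by
        rw [hE]
        intro e he f hf z hz hzf
        have hz' : z = p ∨ z = c ∨ z = q := by
          rcases he with rfl | rfl | rfl <;> rcases Sym2.mem_iff.1 hz with rfl | rfl <;> simp
        rcases hz' with rfl | rfl | rfl <;> rcases hf with rfl | rfl | rfl <;>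
          first | simp; done | contradiction
      edge_generic := by
        rw [hE]
        rintro e (rfl | rfl | rfl) f (rfl | rfl | rfl) hef
        · exact absurd rfl hef
        · exact s1
        · rw [Set.inter_comm]; exact s3
        · rw [Set.inter_comm]; exact s1
        · exact absurd rfl hef
        · exact s2
        · exact s3
        · rw [Set.inter_comm]; exact s2
        · exact absurd rfl hef
      no_triple := by
        rw [hE]
        intro e he f hf g hg hef hfg heg
        rw [Set.eq_empty_iff_forall_notMem]
        rintro z ⟨⟨hz1, hz2⟩, hz3⟩
        apply htri z
        all_goals
          rcases he with rfl | rfl | rfl <;> rcases hf with rfl | rfl | rfl <;>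
            rcases hg with rfl | rfl | rfl <;> first
              | assumption
              | exact absurd rfl hef
              | exact absurd rfl hfg
              | exact absurd rfl heg
      over_crosses := fun _ _ h => h.elim
      over_asymm := fun _ _ h => h.elim }
  refine ⟨D, rfl, fun _ _ h => h, ?_⟩
  have hcc : D.classicalCrossings = ∅ := by
    rw [Set.eq_empty_iff_forall_notMem]
    rintro x ⟨e, f, hf, -⟩
    exact hf
  have hvc : D.virtualCrossings = ∅ := by
    rw [Set.eq_empty_iff_forall_notMem]
    rintro x ⟨e, he, f, hf, hef, -⟩
    exact hshare e he f hf hef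
  rw [numTotal, hcc, hvc]
  simp

/-- Everything but one edge `qp` forms an arc with virtual crossings only. A single detour replaces
it by `p c q`; the arc may cross itself and the edge `qp`. -/
theorem exists_numTotal_eq_zero (D : Diagram) (hD : D.numClassical = 0) :
    ∃ D' : Diagram, D ≈ D' ∧ D'.numTotal = 0 := by
  have hno : ∀ e f, ¬ D.isOver e f := by
    intro e f h
    obtain ⟨x, hx⟩ := (D.over_crosses e f h).2.2.2
    have hmem : x ∈ D.classicalCrossings := ⟨e, f, h, hx⟩
    rw [numClassical, Set.ncard_eq_zero D.classicalCrossings_finite] at hD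
    rw [hD] at hmem
    exact hmem
  obtain ⟨L, hL, h3, hE⟩ := D.exists_list
  obtain ⟨p, M, q, rfl⟩ : ∃ p M q, L = p :: M ++ [q] := by
    cases L with
    | nil => simp at h3
    | cons p L =>
      rcases List.eq_nil_or_concat L with rfl | ⟨M, q, rfl⟩
      · simp at h3
      · exact ⟨p, M, q, by simp⟩
  have hM : M ≠ [] := by rintro rfl; simp at h3
  have hpq : p ≠ q := by
    rintro rfl
    simp at hL
  -- The third vertex is `p` plus the vector `q - p` turned by a right angle, so the determinant is
  -- the squared length of `q - p`.
  have hc : side p q (p + (-(q - p).2, (q - p).1)) ≠ 0 := by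
    have h4 : side p q (p + (-(q - p).2, (q - p).1)) = (q.1 - p.1) ^ 2 + (q.2 - p.2) ^ 2 := by
      simp only [side, cross, Prod.fst_sub, Prod.snd_sub, Prod.fst_add, Prod.snd_add]
      ring
    rw [h4]
    intro h0
    have h5 : q.1 - p.1 = 0 := by nlinarith [sq_nonneg (q.1 - p.1), sq_nonneg (q.2 - p.2)]
    have h6 : q.2 - p.2 = 0 := by nlinarith [sq_nonneg (q.1 - p.1), sq_nonneg (q.2 - p.2)]
    exact hpq (Prod.ext (by linarith) (by linarith))
  generalize p + (-(q - p).2, (q - p).1) = c at hc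
  obtain ⟨D', hE', hno', h0⟩ := exists_triangle hc
  have hL' : (p :: [c] ++ q :: []).Nodup := by
    have hpc : p ≠ c := by rintro rfl; simp at hc
    have hqc : q ≠ c := by rintro rfl; simp at hc
    simp [hpc, hpq, hqc.symm]
  have hE2 := closedEdges_split p q M []
  have hE2' := closedEdges_split p q [c] []
  have hd := disjoint_pathEdges hM hL
  have hd' := disjoint_pathEdges (by simp) hL'
  rw [← hE] at hE2
  change closedEdges [p, c, q] = _ at hE2'
  rw [← hE'] at hE2'
  refine ⟨D', equiv_of_move (Or.inr (Or.inr (Or.inr (Or.inr ⟨p :: M ++ [q], p :: [c] ++ [q],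
    ⟨hL, hL', by simp, ?_, ?_, ?_, ?_, fun e _ f _ => iff_of_false (hno e f) (hno' e f)⟩,
    fun e _ f => ⟨hno e f, hno f e⟩, fun e _ f => ⟨hno' e f, hno' f e⟩⟩)))), h0⟩
  · rw [List.getLast?_concat, List.getLast?_concat]
  · rw [hE2]; exact Set.subset_union_left
  · rw [hE2']; exact Set.subset_union_left
  · rw [hE2, hE2', Set.union_sdiff_left, hd.symm.sdiff_eq_left, Set.union_sdiff_left,
      hd'.symm.sdiff_eq_left]

end Diagram

/-! ### Locating an arc that can be shortened. -/

/-- A polygonal path that contains an edge with a given property can be cut at the first such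
edge. -/
theorem exists_first_edge (C : Sym2 Plane → Prop) (l : List Plane) (h : ∃ e ∈ pathEdges l, C e) :
    ∃ A q q' R, l = A ++ q :: q' :: R ∧ C s(q, q') ∧ ∀ e ∈ pathEdges (A ++ [q]), ¬ C e := by
  induction l with
  | nil => simp [pathEdges] at h
  | cons a l ih =>
    cases l with
    | nil => simp [pathEdges] at h
    | cons b l =>
      by_cases hab : C s(a, b)
      · exact ⟨[], a, b, l, rfl, hab, by simp [pathEdges]⟩
      · obtain ⟨e, he, hC⟩ := h
        have he' : e ∈ pathEdges (b :: l) := he.resolve_left (by rintro rfl; exact hab hC)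
        obtain ⟨A, q, q', R, h1, h2, h3⟩ := ih ⟨e, he', hC⟩
        refine ⟨a :: A, q, q', R, by rw [h1]; rfl, h2, ?_⟩
        cases A with
        | nil =>
          rw [List.nil_append, List.cons.injEq] at h1
          obtain ⟨rfl, -⟩ := h1
          simpa [pathEdges] using hab
        | cons x A =>
          rw [List.cons_append, List.cons.injEq] at h1
          obtain ⟨rfl, -⟩ := h1
          rintro e (rfl | he)
          · exact hab
          · exact h3 e he

namespace Diagram

/-- A separated diagram with two adjacent edges without classical crossings can be shortened. -/
theorem exists_shorter_of_adjacent (D : Diagram) (hs : D.Separated) {L : List Plane}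
    (hL : L.Nodup) (h3 : 3 ≤ L.length) (hE : D.edges = closedEdges L)
    (hcl : ∃ e, D.IsClassical e) {i : ℕ} (hi : ¬ D.IsClassical (edgeAt L i))
    (hi' : ¬ D.IsClassical (edgeAt L (i + 1))) :
    ∃ D' : Diagram, D ≈ D' ∧ D'.numClassical = D.numClassical ∧ D'.Separated ∧
      D'.edges.ncard < D.edges.ncard := by
  have hLne : L ≠ [] := by rintro rfl; simp at h3
  -- Some classical edge is followed by two non-classical ones. Otherwise a consecutive
  -- non-classical pair would propagate backwards around the polygon and leave no classical edge.
  -- Starting at `i + L.length` makes room for a full turn.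
  obtain ⟨j, hj, hj1, hj2⟩ : ∃ j, D.IsClassical (edgeAt L j) ∧ ¬ D.IsClassical (edgeAt L (j + 1)) ∧
      ¬ D.IsClassical (edgeAt L (j + 2)) := by
    by_contra! hcon
    have key : ∀ k t, t + k = i + L.length → ¬ D.IsClassical (edgeAt L t) ∧
        ¬ D.IsClassical (edgeAt L (t + 1)) := by
      intro k
      induction k with
      | zero =>
        rintro t rfl
        rw [add_right_comm, edgeAt_add_length, edgeAt_add_length]
        exact ⟨hi, hi'⟩
      | succ k ih =>
        intro t ht
        obtain ⟨h1, h2⟩ := ih (t + 1) (by omega)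
        exact ⟨fun h => h2 (hcon t h h1), h1⟩
    obtain ⟨e, he⟩ := hcl
    have hem := he.mem
    rw [hE] at hem
    obtain ⟨t, ht, rfl⟩ := mem_closedEdges.1 hem
    exact (key (i + L.length - t) t (by omega)).1 he
  have hr0 := edgeAt_rotate L hLne j 0
  have hr1 := edgeAt_rotate L hLne j 1
  have hr2 := edgeAt_rotate L hLne j 2
  rw [zero_add] at hr0
  rw [add_comm] at hr1 hr2
  rw [← hr0] at hj
  rw [← hr1] at hj1
  rw [← hr2] at hj2
  rw [← closedEdges_rotate L j] at hE
  rw [← List.nodup_rotate (n := j)] at hL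
  rw [← List.length_rotate L j] at h3
  generalize L.rotate j = L' at *
  match L', h3 with
  | p' :: p :: a :: M, _ =>
    rw [edgeAt_zero] at hj
    rw [edgeAt_one] at hj1
    have hE' : D.edges = insert s(p', p) (insert s(p, a) (pathEdges (a :: M ++ [p']))) := by
      rw [hE, closedEdges_cons]
      rfl
    obtain ⟨f, hf⟩ := hj
    have hcf : D.IsClassical f := ⟨_, hf.symm⟩
    have hfm : f ∈ pathEdges (a :: M ++ [p']) := by
      have := hf.mem.2.1
      rw [hE'] at this
      rcases this with rfl | rfl | h
      · exact absurd rfl hf.mem.2.2.ne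
      · exact absurd hcf hj1
      · exact h
    -- The partner `f` of the first edge guarantees that a further classical edge is met; the first
    -- such edge ends the arc.
    obtain ⟨A, q, q', R', h1, h2, h4⟩ := exists_first_edge D.IsClassical _ ⟨f, hfm, hcf⟩
    -- The closing edge ends at `p'`, an end point of the classical edge `p'p`, so it is not
    -- classical and the edge found comes earlier.
    have hR' : R' ≠ [] := by
      rintro rfl
      have h5 : a :: M ++ [p'] = (A ++ [q]) ++ [q'] := by rw [h1]; simp
      obtain ⟨h6, h7⟩ := List.append_inj' h5 rfl
      rw [List.cons.injEq] at h7
      obtain ⟨rfl, -⟩ := h7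
      have hq : q ∈ a :: M := by rw [h6]; simp
      refine hs.notMem ⟨f, hf⟩ h2 ?_ p' (by simp) (by simp)
      intro h
      have : q = p := by
        rcases Sym2.eq_iff.1 h with ⟨rfl, rfl⟩ | ⟨-, rfl⟩ <;> rfl
      subst this
      simp only [List.nodup_cons] at hL
      exact hL.2.1 hq
    obtain ⟨R, r, rfl⟩ := (List.eq_nil_or_concat R').resolve_left hR'
    have h5 : a :: M ++ [p'] = (A ++ q :: q' :: R) ++ [r] := by rw [h1]; simp
    obtain ⟨h6, h7⟩ := List.append_inj' h5 rfl
    rw [List.cons.injEq] at h7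
    obtain ⟨rfl, -⟩ := h7
    -- An empty `A` would make the third edge classical, against the choice of `j`.
    cases A with
    | nil =>
      exfalso
      simp only [List.nil_append, List.cons.injEq] at h6
      obtain ⟨rfl, rfl⟩ := h6
      apply hj2
      have : edgeAt (p' :: p :: a :: q' :: R) 2 = s(a, q') := by
        rw [edgeAt, vertexAt_of_lt (by simp), vertexAt_of_lt (by simp)]
        simp
      rwa [this]
    | cons a' A =>
      have h8 : a = a' := by
        rw [List.cons_append, List.cons.injEq] at h6
        exact h6.1
      subst h8
      rw [h6] at hL hE
      refine D.exists_shorter hs hL hE ⟨f, hf⟩ h2 (by simp) ?_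
      rintro e (rfl | he)
      · exact hj1
      · exact h4 e he

/-! ### Counting edges and crossings. -/

open Classical in
/-- The number of classical edges is at most twice the number of classical crossings. -/
theorem card_classical_le (D : Diagram) :
    (D.edges_finite.toFinset.filter D.IsClassical).card ≤ D.numClassical * 2 := by
  have hsub : D.edges_finite.toFinset.filter D.IsClassical ⊆
      D.classicalCrossings_finite.toFinset.biUnion
        fun x => D.edges_finite.toFinset.filter fun e => x ∈ seg e := by
    intro e he
    rw [Finset.mem_filter] at he
    obtain ⟨h1, f, hf⟩ := he
    obtain ⟨x, hxe, hxf⟩ := hf.mem.2.2.2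
    rw [Finset.mem_biUnion]
    exact ⟨x, (Set.Finite.mem_toFinset _).2 (mem_classicalCrossings.2 ⟨e, f, hf, hxe, hxf⟩),
      Finset.mem_filter.2 ⟨h1, hxe⟩⟩
  refine (Finset.card_le_card hsub).trans ?_
  rw [numClassical, Set.ncard_eq_toFinset_card _ D.classicalCrossings_finite]
  refine Finset.card_biUnion_le_card_mul _ _ _ fun x _ => ?_
  -- Three edges through one crossing would be a triple point.
  by_contra! hcon
  obtain ⟨e, he, f, hf, g, hg, hef, heg, hfg⟩ := Finset.two_lt_card.1 hcon
  simp only [Finset.mem_filter, Set.Finite.mem_toFinset] at he hf hg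
  exact Set.eq_empty_iff_forall_notMem.1 (D.no_triple e he.1 f hf.1 g hg.1 hef hfg heg) x
    ⟨⟨he.2, hf.2⟩, hg.2⟩

open Classical in
/-- If every other edge is classical, at most half of the edges are not classical. -/
theorem card_nonclassical_le (D : Diagram) {L : List Plane} (hL : L.Nodup) (h3 : 3 ≤ L.length)
    (hE : D.edges = closedEdges L)
    (halt : ∀ i, D.IsClassical (edgeAt L i) ∨ D.IsClassical (edgeAt L (i + 1))) :
    (D.edges_finite.toFinset.filter fun e => ¬ D.IsClassical e).card ≤
      (D.edges_finite.toFinset.filter D.IsClassical).card := by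
  have hLne : L ≠ [] := by rintro rfl; simp at h3
  have h1 : (D.edges_finite.toFinset.filter fun e => ¬ D.IsClassical e) ⊆
      ((Finset.range L.length).filter fun i => ¬ D.IsClassical (edgeAt L i)).image (edgeAt L) := by
    intro e he
    rw [Finset.mem_filter, Set.Finite.mem_toFinset, hE] at he
    obtain ⟨i, hi, rfl⟩ := mem_closedEdges.1 he.1
    exact Finset.mem_image.2 ⟨i, Finset.mem_filter.2 ⟨Finset.mem_range.2 hi, he.2⟩, rfl⟩
  refine ((Finset.card_le_card h1).trans Finset.card_image_le).trans ?_
  -- Each non-classical edge is sent to its successor, which is classical.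
  refine Finset.card_le_card_of_injOn (fun i => edgeAt L (i + 1)) ?_ ?_
  · intro i hi
    simp only [Finset.coe_filter, Finset.mem_range, Set.mem_ofPred_eq] at hi
    rw [Finset.mem_coe, Finset.mem_filter, Set.Finite.mem_toFinset, hE]
    exact ⟨edgeAt_mem hLne _, (halt i).resolve_left hi.2⟩
  · intro i hi j hj hij
    simp only [Finset.coe_filter, Finset.mem_range, Set.mem_ofPred_eq] at hi hj
    dsimp only at hij
    have hpos := List.length_pos_of_ne_nil hLne
    rw [← edgeAt_mod L (i + 1), ← edgeAt_mod L (j + 1)] at hij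
    have h2 := edgeAt_inj hL h3 (Nat.mod_lt _ hpos) (Nat.mod_lt _ hpos) hij
    have h4 : i ≡ j [MOD L.length] := Nat.ModEq.add_right_cancel' 1 h2
    rwa [Nat.ModEq, Nat.mod_eq_of_lt hi.1, Nat.mod_eq_of_lt hj.1] at h4

open Classical in
/-- The virtual crossings of a separated diagram in which every other edge is classical. -/
theorem ncard_virtualCrossings_le (D : Diagram) (hs : D.Separated) {L : List Plane}
    (hE : D.edges = closedEdges L)
    (halt : ∀ i, D.IsClassical (edgeAt L i) ∨ D.IsClassical (edgeAt L (i + 1))) :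
    D.virtualCrossings.ncard ≤
      (D.edges_finite.toFinset.filter fun e => ¬ D.IsClassical e).card *
        ((D.edges_finite.toFinset.filter D.IsClassical).card - 1) +
      (D.edges_finite.toFinset.filter fun e => ¬ D.IsClassical e).card.choose 2 := by
  set N := D.edges_finite.toFinset.filter fun e => ¬ D.IsClassical e with hN
  set C := D.edges_finite.toFinset.filter D.IsClassical with hC
  have hNmem : ∀ {e}, e ∈ N ↔ e ∈ D.edges ∧ ¬ D.IsClassical e := by
    intro e; rw [hN, Finset.mem_filter, Set.Finite.mem_toFinset]
  have hCmem : ∀ {e}, e ∈ C ↔ D.IsClassical e := by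
    intro e
    rw [hC, Finset.mem_filter, Set.Finite.mem_toFinset]
    exact ⟨fun h => h.2, fun h => ⟨h.mem, h⟩⟩
  let T₁ : Finset (Finset (Sym2 Plane)) :=
    N.biUnion fun e => (C.filter fun f => Crosses e f).image fun f => {e, f}
  have hT₁ : T₁.card ≤ N.card * (C.card - 1) := by
    -- The `- 1` comes from the classical successor of the edge, which shares an end point with it
    -- and so does not cross it.
    refine Finset.card_biUnion_le_card_mul _ _ _ fun e he => Finset.card_image_le.trans ?_
    have he' := (hNmem.1 he).1
    rw [hE] at he'
    obtain ⟨i, hi, rfl⟩ := mem_closedEdges.1 he'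
    have hf : edgeAt L (i + 1) ∈ C :=
      hCmem.2 ((halt i).resolve_left (hNmem.1 he).2)
    rw [← Finset.card_erase_of_mem hf]
    refine Finset.card_le_card fun f hf' => ?_
    rw [Finset.mem_filter] at hf'
    refine Finset.mem_erase.2 ⟨?_, hf'.1⟩
    rintro rfl
    exact hf'.2.1 (vertexAt L (i + 1)) (by simp [edgeAt]) (by simp [edgeAt])
  have hchoose : ∀ x ∈ D.virtualCrossings, ∃ t ∈ T₁ ∪ N.powersetCard 2,
      ∃ e ∈ D.edges, ∃ f ∈ D.edges, e ≠ f ∧ t = {e, f} ∧ x ∈ seg e ∧ x ∈ seg f := by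
    rintro x ⟨e, he, f, hf, hc, h1, h2, hxe, hxf⟩
    have hT : ∀ {e f}, e ∈ D.edges → Crosses e f → ¬ D.IsClassical e → D.IsClassical f →
        ({e, f} : Finset (Sym2 Plane)) ∈ T₁ := fun he hc h1 h2 =>
      Finset.mem_biUnion.2 ⟨_, hNmem.2 ⟨he, h1⟩, Finset.mem_image.2
        ⟨_, Finset.mem_filter.2 ⟨hCmem.2 h2, hc⟩, rfl⟩⟩
    by_cases hec : D.IsClassical e
    · by_cases hfc : D.IsClassical f
      · rcases hs.linked_of_crosses hec hfc hc with h | h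
        · exact absurd h h1
        · exact absurd h h2
      · exact ⟨{f, e}, Finset.mem_union_left _ (hT hf hc.symm hfc hec), f, hf, e, he, hc.ne.symm,
          rfl, hxf, hxe⟩
    · by_cases hfc : D.IsClassical f
      · exact ⟨{e, f}, Finset.mem_union_left _ (hT he hc hec hfc), e, he, f, hf, hc.ne, rfl,
          hxe, hxf⟩
      · refine ⟨{e, f}, Finset.mem_union_right _ (Finset.mem_powersetCard.2 ⟨?_, ?_⟩), e, he, f, hf,
          hc.ne, rfl, hxe, hxf⟩
        · intro g hg
          rw [Finset.mem_insert, Finset.mem_singleton] at hg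
          rcases hg with rfl | rfl
          · exact hNmem.2 ⟨he, hec⟩
          · exact hNmem.2 ⟨hf, hfc⟩
        · exact Finset.card_pair hc.ne
  choose! t ht htx using hchoose
  -- Two edges meet at most once, so a crossing is determined by its pair of edges.
  have hinj : Set.InjOn t D.virtualCrossings := by
    intro x hx y hy hxy
    obtain ⟨e, he, f, hf, hef, h1, hxe, hxf⟩ := htx x hx
    obtain ⟨e', -, f', -, -, h2, hye, hyf⟩ := htx y hy
    have key : ∀ g ∈ t x, y ∈ seg g := by
      intro g hg
      rw [hxy, h2, Finset.mem_insert, Finset.mem_singleton] at hg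
      rcases hg with rfl | rfl
      · exact hye
      · exact hyf
    exact D.edge_generic e he f hf hef ⟨hxe, hxf⟩
      ⟨key e (by rw [h1]; simp), key f (by rw [h1]; simp)⟩
  have hcard : D.virtualCrossings.ncard ≤ (T₁ ∪ N.powersetCard 2).card := by
    rw [Set.ncard_eq_toFinset_card _ D.virtualCrossings_finite]
    refine Finset.card_le_card_of_injOn t ?_ ?_
    · intro x hx
      exact ht x (by simpa using hx)
    · simpa using hinj
  refine hcard.trans ((Finset.card_union_le _ _).trans ?_)
  rw [Finset.card_powersetCard]
  exact Nat.add_le_add_right hT₁ _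

/-- A diagram with `n` classical crossings is equivalent to one with at most `n + 3 n (2 n - 1)`
crossings. -/
theorem exists_numTotal_le (D : Diagram) : ∃ D' : Diagram, D ≈ D' ∧
    D'.numTotal ≤ D.numClassical + 3 * (D.numClassical * (2 * D.numClassical - 1)) := by
  classical
  rcases Nat.eq_zero_or_pos D.numClassical with hn | hn
  · obtain ⟨D', h1, h2⟩ := D.exists_numTotal_eq_zero hn
    exact ⟨D', h1, by omega⟩
  -- The representative is chosen with the fewest edges among all separated ones that have the given
  -- number of classical crossings.
  have hex : ∃ m, ∃ D' : Diagram, D ≈ D' ∧ D'.numClassical = D.numClassical ∧ D'.Separated ∧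
      D'.edges.ncard = m := by
    obtain ⟨D', h1, h2, h3⟩ := D.exists_separated
    exact ⟨_, D', h1, h2, h3, rfl⟩
  obtain ⟨D', h1, h2, hs, h4⟩ := Nat.find_spec hex
  have hmin := fun m hm => Nat.find_min hex (m := m) hm
  rw [← h4] at hmin
  obtain ⟨L, hL, h3, hE⟩ := D'.exists_list
  have hcl : ∃ e, D'.IsClassical e := by
    have hpos : 0 < D'.classicalCrossings.ncard := lt_of_lt_of_eq hn h2.symm
    obtain ⟨x, e, f, hf, -⟩ := (Set.ncard_pos D'.classicalCrossings_finite).1 hpos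
    exact ⟨e, f, Or.inl hf⟩
  have halt : ∀ i, D'.IsClassical (edgeAt L i) ∨ D'.IsClassical (edgeAt L (i + 1)) := by
    intro i
    by_contra! hcon
    obtain ⟨D'', h5, h6, h7, h8⟩ := D'.exists_shorter_of_adjacent hs hL h3 hE hcl hcon.1 hcon.2
    exact hmin _ h8 ⟨D'', Setoid.trans h1 h5, h6.trans h2, h7, rfl⟩
  refine ⟨D', h1, ?_⟩
  have hc := D'.card_classical_le
  have hk := D'.card_nonclassical_le hL h3 hE halt
  have hv := D'.ncard_virtualCrossings_le hs hE halt
  rw [h2] at hc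
  have hcc : D'.classicalCrossings.ncard = D.numClassical := h2
  rw [numTotal, hcc]
  generalize (D'.edges_finite.toFinset.filter fun e => ¬ D'.IsClassical e).card = k at *
  generalize (D'.edges_finite.toFinset.filter D'.IsClassical).card = c at *
  generalize D.numClassical = n at *
  -- With `k ≤ c ≤ 2n`, the mixed pairs contribute `2n(2n-1)` and the non-classical pairs `n(2n-1)`.
  have e1 : k * (c - 1) ≤ (2 * n) * (2 * n - 1) :=
    Nat.mul_le_mul (by omega) (by omega)
  have e2 : k.choose 2 ≤ n * (2 * n - 1) := by
    refine (Nat.choose_le_choose 2 (by omega : k ≤ 2 * n)).trans ?_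
    rw [Nat.choose_two_right, mul_assoc, Nat.mul_div_cancel_left _ two_pos]
  have e3 : (2 * n) * (2 * n - 1) = 2 * (n * (2 * n - 1)) := by ring
  omega

end Diagram
end VirtualKnot

theorem proposition2p9 (K : VirtualKnot.Knot) (n : ℕ) (hn : K.classicalCrossingNumber = n) :
    (K.totalCrossingNumber : ℤ) ≤ 6 * (n : ℤ) ^ 2 - 2 * (n : ℤ) := by
  obtain ⟨D, hD, hDn⟩ : ∃ D : VirtualKnot.Diagram,
      (Quotient.mk VirtualKnot.Diagram.setoid D : VirtualKnot.Knot) = K ∧ D.numClassical = n := by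
    rw [← hn]
    obtain ⟨D, hD⟩ := Quotient.exists_rep K
    -- A representative of `K` shows that the set is nonempty, so its infimum is attained and is not
    -- the default value `0`.
    exact Nat.sInf_mem (s := {n | ∃ D : VirtualKnot.Diagram,
      (Quotient.mk VirtualKnot.Diagram.setoid D : VirtualKnot.Knot) = K ∧ D.numClassical = n})
      ⟨_, D, hD, rfl⟩
  obtain ⟨D', hDD', hle⟩ := D.exists_numTotal_le
  have h : K.totalCrossingNumber ≤ D'.numTotal :=
    Nat.sInf_le ⟨D', by rw [← hD]; exact (Quotient.sound hDD').symm, rfl⟩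
  rw [hDn] at hle
  have hle := h.trans hle
  -- For `n = 0` the natural subtraction in `2 * n - 1` truncates, so the cast to the integers needs
  -- `n` positive.
  rcases Nat.eq_zero_or_pos n with rfl | hpos
  · simp at hle
    simp [hle]
  · zify [show 1 ≤ 2 * n by omega] at hle
    nlinarith
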